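/- Let $\epsilon_0,\delta_0>0$, $\Delta=\{z\in\mathbb C: |z|<\epsilon_0\}$, and let $P:\Delta\to\mathbb R$ and $Q:\Delta\times(-\delta_0,\delta_0)\to\mathbb R$ be $C^\infty$-smooth functions such that (i) $P(0)=0$ and $Q(0,0)=0$; (ii) $P(z_2)=P(|z_2|)$ and $Q(z_2,t)=Q(|z_2|,t)$ for all $z_2\in\Delta$ and $t\in(-\delta_0,\delta_0)$; (iii) $P(z_2)>0$ for all $z_2\in\Delta\setminus\{0\}$; (iv) $P$ vanishes to infinite order at $0$, that is, all partial derivatives of $P$ (with respect to the real coordinates of $\mathbb C=\mathbb R^2$) of all orders are zero at $0$. Let $(M,0)$ be the germ at $0\in\mathbb C^2$ of the real hypersurface $$\mathrm{Re}\, z_1+P(z_2)+(\mathrm{Im}\, z_1)\,Q(z_2,\mathrm{Im}\, z_1)=0 ,$$ and let $\mathrm{Aut}(M,0)$ be its stability group, that is, the set of germs at $0$ of biholomorphisms $f$ between neighbourhoods of $0$ in $\mathbb C^2$ with $f(0)=0$ that map the germ of $M$ into itself. Then $$\mathrm{Aut}(M,0)=\{R_t : t\in\mathbb R\},\qquad R_t(z_1,z_2)=(z_1,e^{it}z_2),$$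 as germs at $0$. -/

import Mathlib

open scoped ContDiff Topology

/-- A real function on a real normed space vanishes to infinite order at `x`:
all its partial derivatives of all orders (including the value itself) are zero at `x`. -/
def VanishesToInfiniteOrderAt {E : Type*} [NormedAddCommGroup E] [NormedSpace ℝ E]
    (P : E → ℝ) (x : E) : Prop :=
  ∀ n : ℕ, iteratedFDeriv ℝ n P x = 0

/-- `f` is, near `p`, a biholomorphism of a neighbourhood of `p` onto a neighbourhood of `f p`:
it is holomorphic near `p` and has a holomorphic two-sided local inverse. -/
def IsLocalBiholomorphismAt (f : ℂ × ℂ → ℂ × ℂ) (p : ℂ × ℂ) : Prop :=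
  AnalyticAt ℂ f p ∧
    ∃ g : ℂ × ℂ → ℂ × ℂ, AnalyticAt ℂ g (f p) ∧
      (∀ᶠ z in 𝓝 p, g (f z) = z) ∧ (∀ᶠ w in 𝓝 (f p), f (g w) = w)

/-- The stability group `Aut(M, p)` of the germ at `p` of a subset `M` of `ℂ²`: the germs at `p`
of biholomorphisms that fix `p` and map (the germ at `p` of) `M` into itself. -/
def stabilityGroup (M : Set (ℂ × ℂ)) (p : ℂ × ℂ) : Set ((𝓝 p).Germ (ℂ × ℂ)) :=
  {F | ∃ f : ℂ × ℂ → ℂ × ℂ, F = (f : (𝓝 p).Germ (ℂ × ℂ)) ∧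
    IsLocalBiholomorphismAt f p ∧ f p = p ∧ ∀ᶠ z in 𝓝 p, z ∈ M → f z ∈ M}

/-- The hypersurface `Re z₁ + P(z₂) + Im z₁ · Q(z₂, Im z₁) = 0`,
over `|z₂| < ε₀`, `|Im z₁| < δ₀`. -/
def graphHypersurface (ε₀ δ₀ : ℝ) (P : ℂ → ℝ) (Q : ℂ → ℝ → ℝ) : Set (ℂ × ℂ) :=
  {z | ‖z.2‖ < ε₀ ∧ |z.1.im| < δ₀ ∧ z.1.re + P z.2 + z.1.im * Q z.2 z.1.im = 0}

/-- The rotationMap `R_t(z₁, z₂) = (z₁, e^{it} z₂)`. -/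
noncomputable def rotationMap (t : ℝ) (z : ℂ × ℂ) : ℂ × ℂ :=
  (z.1, Complex.exp (Complex.I * t) * z.2)

/-!
Over `z₂ = z` the hypersurface has the points `(P(z) ζ, z)` with `Im ζ = τ` and `ζ → -1 + iτ` as
`z → 0`. Substitute them into the equation satisfied by a self-map `F` and write
`φ = F₂(0, ·)`, `H = ∂₁F₁(0, ·)`. Flatness of `P` forces `F₁(0, ·) = 0`, and to first order in `P`
it forces `|φ'(0)| = 1`, since `P` is positive and cannot stay dominated by its own values at
smaller radii. After a rotation, `φ = id` and `H = 1`.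

Suppose now that `F` is tangent to the identity to order `j` along `z₁ = 0`, the next terms being
`α(z₂) z₁ ^ (j + 1)` and `β(z₂) z₁ ^ j`. To leading order the equation is polynomial in `τ`, hence
holds at `iτ = 1`, where it relates `2 α(ru)` to `(P'/P)(r) ū β(ru)` for every `|u| = 1`.
By flatness `r P'(r) / P(r)` is unbounded as `r → 0`, and along radii where it tends to infinity
this is impossible for holomorphic `α, β` unless both vanish. So every coefficient vanishes and
`F` is a rotation.
-/

open Filter Asymptotics

/-! ### Analytic germs at the origin -/

theorem isBigO_norm_pow_of_le {E : Type*} [SeminormedAddCommGroup E] {m n : ℕ} (h : n ≤ m) :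
    (fun z : E => ‖z‖ ^ m) =O[𝓝 0] fun z => ‖z‖ ^ n := by
  rcases h.eq_or_lt with rfl | h
  · exact isBigO_refl _ _
  · exact ((isLittleO_pow_pow h).comp_tendsto tendsto_norm_zero).isBigO

theorem eventually_eq_zero_of_isBigO_norm_pow {𝕜 E F : Type*} [NontriviallyNormedField 𝕜]
    [NormedAddCommGroup E] [NormedSpace 𝕜 E] [NormedAddCommGroup F] [NormedSpace 𝕜 F]
    {f : E → F} (hf : AnalyticAt 𝕜 f 0) (h : ∀ n : ℕ, f =O[𝓝 0] fun z => ‖z‖ ^ n) :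
    ∀ᶠ z in 𝓝 0, f z = 0 := by
  obtain ⟨p, hp⟩ := hf
  have hterm : ∀ n y, (p n fun _ => y) = 0 := by
    intro n
    induction n using Nat.strong_induction_on with
    | _ n ih =>
      have hpartial : p.partialSum (n + 1) = fun y => p n fun _ => y := by
        funext y
        refine Finset.sum_eq_single n (fun k hk hkn => ih k ?_ y) (by simp)
        exact (Finset.mem_range_succ_iff.1 hk).lt_of_ne hkn
      have hremainder := hp.isBigO_sub_partialSum_pow (n + 1)
      simp only [zero_add, hpartial] at hremainder
      refine IsBigO.continuousMultilinearMap_apply_eq_zero ?_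
      simpa using (h (n + 1)).sub hremainder
  filter_upwards [hp.eventually_hasSum_sub] with z hz
  exact hz.unique (by simp [hterm])

theorem exists_eventually_eq_pow_mul {g : ℂ → ℂ} (hg : AnalyticAt ℂ g 0)
    (hne : ¬ ∀ᶠ z in 𝓝 0, g z = 0) :
    ∃ (l : ℕ) (q : ℂ → ℂ), AnalyticAt ℂ q 0 ∧ q 0 ≠ 0 ∧ ∀ᶠ z in 𝓝 0, g z = z ^ l * q z := by
  simpa using hg.exists_eventuallyEq_pow_smul_nonzero_iff.2 hne

theorem tendsto_ofReal_mul_punctured {u : ℂ} (hu : u ≠ 0) :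
    Tendsto (fun r : ℝ => (r : ℂ) * u) (𝓝[>] 0) (𝓝[≠] 0) := by
  refine tendsto_nhdsWithin_iff.2 ⟨?_, ?_⟩
  · exact ((Complex.continuous_ofReal.mul continuous_const).tendsto' 0 0 (by simp)).mono_left
      nhdsWithin_le_nhds
  · filter_upwards [self_mem_nhdsWithin] with r hr
    exact mul_ne_zero (Complex.ofReal_ne_zero.2 (ne_of_gt hr)) hu

theorem tendsto_ofReal_mul_zero (u : ℂ) : Tendsto (fun r : ℝ => (r : ℂ) * u) (𝓝[>] 0) (𝓝 0) :=
  ((Complex.continuous_ofReal.mul continuous_const).tendsto' 0 0 (by simp)).mono_left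
    nhdsWithin_le_nhds

theorem tendsto_ray_div_pow {g q : ℂ → ℂ} {l : ℕ} (hq : ContinuousAt q 0)
    (hg : ∀ᶠ z in 𝓝 0, g z = z ^ l * q z) (u : ℂ) :
    Tendsto (fun r : ℝ => g (r * u) / (r : ℂ) ^ l) (𝓝[>] 0) (𝓝 (u ^ l * q 0)) := by
  refine ((hq.tendsto.comp (tendsto_ofReal_mul_zero u)).const_mul (u ^ l)).congr' ?_
  filter_upwards [(tendsto_ofReal_mul_zero u).eventually hg, self_mem_nhdsWithin] with r hr hr0
  have hr0 : (r : ℂ) ≠ 0 := Complex.ofReal_ne_zero.2 (ne_of_gt hr0)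
  rw [hr, Function.comp_apply, mul_pow]
  field_simp

theorem exists_unit_mul_pow_eq {c w : ℂ} (hc : c ≠ 0) (hw : ‖w‖ = 1) {l : ℕ} (hl : l ≠ 0) :
    ∃ u : ℂ, ‖u‖ = 1 ∧ c * u ^ l = ‖c‖ * w := by
  obtain ⟨u, hu⟩ := IsAlgClosed.exists_pow_nat_eq ((‖c‖ : ℂ) * w / c) (Nat.pos_of_ne_zero hl)
  refine ⟨u, ?_, ?_⟩
  · have hpow : ‖u‖ ^ l = 1 := by
      rw [← norm_pow, hu]
      simp [hw, hc]
    exact (pow_eq_one_iff_of_nonneg (norm_nonneg u) hl).1 hpow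
  · rw [hu]
    field_simp

theorem ne_zero_of_norm_eq_one {u : ℂ} (hu : ‖u‖ = 1) : u ≠ 0 :=
  norm_ne_zero_iff.1 (hu ▸ one_ne_zero)

theorem eq_of_forall_unit_pow_eq {k l : ℕ} (h : ∀ u : ℂ, ‖u‖ = 1 → u ^ k = u ^ l) : k = l := by
  wlog hkl : k ≤ l generalizing k l
  · exact (this (fun u hu => (h u hu).symm) (le_of_not_ge hkl)).symm
  obtain ⟨d, rfl⟩ := Nat.exists_eq_add_of_le hkl
  by_contra hne
  obtain ⟨u, hu, hu'⟩ := exists_unit_mul_pow_eq (c := 1) (w := -1) one_ne_zero (by simp)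
    (l := d) (by omega)
  have hud : u ^ d = 1 := by
    simpa [pow_add, ne_zero_of_norm_eq_one hu] using (h u hu).symm
  norm_num [hud] at hu'

/- If `g` had order `l < n`, then in a direction `u` where its leading term `c u ^ l` is positive
the real part would be of exact order `l`. -/
theorem isBigO_norm_pow_of_re_add_im_mul {g : ℂ → ℂ} (hg : AnalyticAt ℂ g 0) (hg0 : g 0 = 0)
    {q : ℂ → ℝ} (hq : Tendsto q (𝓝[≠] 0) (𝓝 0)) {n : ℕ}
    (h : (fun z => (g z).re + (g z).im * q z) =O[𝓝[≠] 0] fun z => ‖z‖ ^ n) :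
    g =O[𝓝 0] fun z => ‖z‖ ^ n := by
  by_cases hne : ∀ᶠ z in 𝓝 0, g z = 0
  · exact (isBigO_zero _ _).congr' (hne.mono fun z hz => hz.symm) EventuallyEq.rfl
  obtain ⟨l, c, hc, hc0, hgc⟩ := exists_eventually_eq_pow_mul hg hne
  by_cases hln : n ≤ l
  · have hpow : (fun z : ℂ => z ^ l * c z) =O[𝓝 0] fun z => ‖z‖ ^ l * (1 : ℝ) :=
      (isBigO_of_le _ fun z => by simp).mul (hc.continuousAt.isBigO_one ℝ)
    simp only [mul_one] at hpow
    exact (EventuallyEq.trans_isBigO hgc hpow).trans (isBigO_norm_pow_of_le hln)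
  have hl : l ≠ 0 := by
    rintro rfl
    exact hc0 (by simpa [hg0] using hgc.self_of_nhds.symm)
  obtain ⟨u, hu, hcu⟩ := exists_unit_mul_pow_eq (w := 1) hc0 (by simp) hl
  have hray := tendsto_ray_div_pow hc.continuousAt hgc u
  rw [mul_comm, hcu, mul_one] at hray
  have hpunctured := tendsto_ofReal_mul_punctured (ne_zero_of_norm_eq_one hu)
  have hlim := (Complex.continuous_re.tendsto _ |>.comp hray).add
    ((Complex.continuous_im.tendsto _ |>.comp hray).mul (hq.comp hpunctured))
  have hsmall : (fun r : ℝ => (g (r * u)).re + (g (r * u)).im * q (r * u)) =o[𝓝[>] 0]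
      fun r => r ^ l := by
    refine ((h.comp_tendsto hpunctured).trans (isBigO_of_le (g := fun r : ℝ => r ^ n) _
      fun r => by simp [hu])).trans_isLittleO ?_
    exact (isLittleO_pow_pow (not_le.1 hln)).mono nhdsWithin_le_nhds
  have hzero : ‖c 0‖ = 0 := by
    refine tendsto_nhds_unique ?_ hsmall.tendsto_div_nhds_zero
    refine (by simpa using hlim : Tendsto _ _ (𝓝 ‖c 0‖)).congr fun r => ?_
    rw [← Complex.ofReal_pow, Complex.div_ofReal_re, Complex.div_ofReal_im]
    ring
  exact absurd (norm_eq_zero.1 hzero) hc0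

theorem tendsto_ofReal_punctured : Tendsto (fun r : ℝ => (r : ℂ)) (𝓝[>] 0) (𝓝[≠] 0) := by
  simpa using tendsto_ofReal_mul_punctured one_ne_zero

theorem tendsto_ofReal_zero : Tendsto (fun r : ℝ => (r : ℂ)) (𝓝[>] 0) (𝓝 0) :=
  tendsto_ofReal_punctured.mono_right nhdsWithin_le_nhds

theorem exists_eq_add_pow_mul {φ : ℂ → ℂ} (hφ : AnalyticAt ℂ φ 0) (hφ0 : φ 0 = 0)
    (hderiv : deriv φ 0 = 1) (hne : ¬ ∀ᶠ z in 𝓝 0, φ z = z) : ∃ (q : ℂ → ℂ) (k : ℕ), k ≠ 0 ∧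
      ContinuousAt q 0 ∧ q 0 ≠ 0 ∧ ∀ᶠ z in 𝓝 0, φ z = z + z ^ (k + 1) * q z := by
  have hsub : AnalyticAt ℂ (fun z => φ z - z) 0 := hφ.sub analyticAt_id
  obtain ⟨l, q, hq, hq0, hlq⟩ := exists_eventually_eq_pow_mul hsub
    fun h => hne (h.mono fun z hz => sub_eq_zero.1 hz)
  have hsub' : HasDerivAt (fun z => φ z - z) 0 0 :=
    (hφ.differentiableAt.hasDerivAt.sub (hasDerivAt_id 0)).congr_deriv (by rw [hderiv, sub_self])
  have hl : 2 ≤ l := by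
    by_contra! hlt
    interval_cases l
    · exact hq0 (by simpa [hφ0] using hlq.self_of_nhds.symm)
    · have hprod : HasDerivAt (fun z => z ^ 1 * q z) (q 0) 0 :=
        ((hasDerivAt_pow 1 (0 : ℂ)).mul hq.differentiableAt.hasDerivAt).congr_deriv (by simp)
      exact hq0 (hprod.unique (hsub'.congr_of_eventuallyEq (hlq.mono fun z hz => hz.symm)))
  refine ⟨q, l - 1, by omega, hq.continuousAt, hq0, hlq.mono fun z hz => ?_⟩
  rw [Nat.sub_add_cancel (by omega), ← hz, add_sub_cancel]

/-! ### Expansion in the first variable -/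

/-- The partial derivative with respect to the first variable. -/
noncomputable def partialFst (F : ℂ × ℂ → ℂ) (z : ℂ × ℂ) : ℂ := fderiv ℂ F z (1, 0)

theorem analyticAt_partialFst {F : ℂ × ℂ → ℂ} {z : ℂ × ℂ} (h : AnalyticAt ℂ F z) :
    AnalyticAt ℂ (partialFst F) z :=
  ((ContinuousLinearMap.apply ℂ ℂ ((1 : ℂ), (0 : ℂ))).analyticAt _).comp h.fderiv

theorem hasDerivAt_partialFst {F : ℂ × ℂ → ℂ} {z : ℂ × ℂ} (h : AnalyticAt ℂ F z) :
    HasDerivAt (fun w => F (w, z.2)) (partialFst F z) z.1 := by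
  have hF : HasFDerivAt F (fderiv ℂ F z) (z.1, z.2) := h.differentiableAt.hasFDerivAt
  exact hF.comp_hasDerivAt z.1 ((hasDerivAt_id z.1).prodMk (hasDerivAt_const z.1 z.2))

theorem analyticAt_zero_left {F : ℂ × ℂ → ℂ} (h : AnalyticAt ℂ F 0) :
    AnalyticAt ℂ (fun w : ℂ => F (0, w)) 0 :=
  AnalyticAt.comp (f := fun w : ℂ => ((0 : ℂ), w)) h (analyticAt_const.prod analyticAt_id)

theorem tendsto_snd_zero : Tendsto (Prod.snd : ℂ × ℂ → ℂ) (𝓝 0) (𝓝 0) :=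
  continuous_snd.tendsto' 0 0 rfl

theorem norm_lt_iff {z : ℂ × ℂ} {ε : ℝ} : ‖z‖ < ε ↔ ‖z.1‖ < ε ∧ ‖z.2‖ < ε := by
  rw [Prod.norm_def, max_lt_iff]

theorem isBigO_fst_pow_succ_of_hasDerivAt {G G' : ℂ × ℂ → ℂ} {n : ℕ}
    (hG : ∀ᶠ z in 𝓝 0, HasDerivAt (fun w => G (w, z.2)) (G' z) z.1)
    (hG0 : ∀ᶠ w in 𝓝 0, G (0, w) = 0) (hG' : G' =O[𝓝 0] fun z => ‖z.1‖ ^ n) :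
    G =O[𝓝 0] fun z => ‖z.1‖ ^ (n + 1) := by
  obtain ⟨C, hC, hbound⟩ := hG'.exists_nonneg
  obtain ⟨ε, hε, hball⟩ := Metric.eventually_nhds_iff_ball.1
    ((hG.and hbound.bound).and (tendsto_snd_zero.eventually hG0))
  refine IsBigO.of_bound C ?_
  filter_upwards [Metric.ball_mem_nhds (0 : ℂ × ℂ) hε] with z hz
  have hsegment : ∀ w ∈ Metric.closedBall (0 : ℂ) ‖z.1‖, (w, z.2) ∈ Metric.ball 0 ε := by
    intro w hw
    rw [mem_ball_zero_iff, norm_lt_iff] at hz ⊢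
    exact ⟨(mem_closedBall_zero_iff.1 hw).trans_lt hz.1, hz.2⟩
  have hmean := (convex_closedBall (0 : ℂ) ‖z.1‖).norm_image_sub_le_of_norm_hasDerivWithin_le
    (f := fun w => G (w, z.2)) (f' := fun w => G' (w, z.2)) (C := C * ‖z.1‖ ^ n) (x := 0) (y := z.1)
    (fun w hw => (hball _ (hsegment w hw)).1.1.hasDerivWithinAt) ?_ (by simp) (by simp)
  · simpa [(hball z hz).2, pow_succ, mul_assoc] using hmean
  · intro w hw
    refine (hball _ (hsegment w hw)).1.2.trans ?_
    rw [norm_pow, norm_norm]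
    gcongr
    exact mem_closedBall_zero_iff.1 hw

/-- The coefficient of `z₁ ^ n` in the expansion of `F` in powers of the first variable,
as a function of the second one. -/
noncomputable def fstCoeff (F : ℂ × ℂ → ℂ) (n : ℕ) (w : ℂ) : ℂ :=
  partialFst^[n] F (0, w) / n.factorial

@[simp]
theorem fstCoeff_zero (F : ℂ × ℂ → ℂ) (w : ℂ) : fstCoeff F 0 w = F (0, w) := by
  simp [fstCoeff]

theorem fstCoeff_one (F : ℂ × ℂ → ℂ) (w : ℂ) : fstCoeff F 1 w = partialFst F (0, w) := by
  simp [fstCoeff]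

theorem fstCoeff_partialFst (F : ℂ × ℂ → ℂ) (n : ℕ) (w : ℂ) :
    fstCoeff (partialFst F) n w = (n + 1) * fstCoeff F (n + 1) w := by
  have hfactorial : (n.factorial : ℂ) ≠ 0 := by exact_mod_cast n.factorial_ne_zero
  have hsucc : (n : ℂ) + 1 ≠ 0 := by exact_mod_cast n.succ_ne_zero
  simp only [fstCoeff, Function.iterate_succ_apply, Nat.factorial_succ, Nat.cast_mul,
    Nat.cast_succ]
  field_simp

theorem analyticAt_fstCoeff {F : ℂ × ℂ → ℂ} (hF : AnalyticAt ℂ F 0) (n : ℕ) :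
    AnalyticAt ℂ (fstCoeff F n) 0 := by
  have hiterate : AnalyticAt ℂ (partialFst^[n] F) 0 := by
    induction n generalizing F with
    | zero => exact hF
    | succ _ ih => exact ih (analyticAt_partialFst hF)
  exact (analyticAt_zero_left hiterate).div_const

theorem sub_pow_mul_fstCoeff_isBigO {F : ℂ × ℂ → ℂ} (hF : AnalyticAt ℂ F 0) {n : ℕ}
    (h : ∀ m < n, ∀ᶠ w in 𝓝 0, fstCoeff F m w = 0) :
    (fun z => F z - z.1 ^ n * fstCoeff F n z.2) =O[𝓝 0] fun z => ‖z.1‖ ^ (n + 1) := by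
  induction n generalizing F with
  | zero =>
    refine isBigO_fst_pow_succ_of_hasDerivAt (G' := partialFst F) ?_ (by simp) ?_
    · filter_upwards [hF.eventually_analyticAt] with z hz
      simpa using (hasDerivAt_partialFst hz).sub_const (F (0, z.2))
    · simpa using (analyticAt_partialFst hF).continuousAt.isBigO_one ℝ
  | succ n ih =>
    refine isBigO_fst_pow_succ_of_hasDerivAt ?_ ?_ (ih (analyticAt_partialFst hF) ?_)
    · filter_upwards [hF.eventually_analyticAt] with z hz
      have hpow := (hasDerivAt_pow (n + 1) z.1).mul_const (fstCoeff F (n + 1) z.2)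
      refine ((hasDerivAt_partialFst hz).sub hpow).congr_deriv ?_
      rw [fstCoeff_partialFst]
      push_cast [Nat.add_sub_cancel]
      ring
    · filter_upwards [h 0 n.succ_pos] with w hw
      simpa using hw
    · intro m hm
      filter_upwards [h (m + 1) (by omega)] with w hw
      rw [fstCoeff_partialFst, hw, mul_zero]

theorem eventually_eq_zero_of_fstCoeff {F : ℂ × ℂ → ℂ} (hF : AnalyticAt ℂ F 0)
    (h : ∀ n : ℕ, ∀ᶠ w in 𝓝 0, fstCoeff F n w = 0) : ∀ᶠ z in 𝓝 0, F z = 0 := by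
  refine eventually_eq_zero_of_isBigO_norm_pow hF fun n => ?_
  have hremainder : F =O[𝓝 0] fun z : ℂ × ℂ => ‖z.1‖ ^ (n + 1) := by
    refine (sub_pow_mul_fstCoeff_isBigO hF fun m _ => h m).congr' ?_ EventuallyEq.rfl
    filter_upwards [tendsto_snd_zero.eventually (h n)] with z hz
    rw [hz, mul_zero, sub_zero]
  refine (hremainder.trans (isBigO_of_le _ fun z => ?_)).trans (isBigO_norm_pow_of_le n.le_succ)
  rw [norm_pow, norm_norm, norm_pow, norm_norm]
  gcongr
  exact norm_fst_le z

/-! ### Flat functions -/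

section MeanValue

variable {E F : Type*} [NormedAddCommGroup E] [NormedSpace ℝ E] [NormedAddCommGroup F]
  [NormedSpace ℝ F] {f : E → F} {N : ℕ}

theorem norm_le_of_mem_segment {p : E × E} {w : E} (hw : w ∈ segment ℝ p.2 p.1) : ‖w‖ ≤ ‖p‖ := by
  have hsubset := (convex_closedBall (0 : E) ‖p‖).segment_subset
    (mem_closedBall_zero_iff.2 (norm_snd_le p)) (mem_closedBall_zero_iff.2 (norm_fst_le p))
  exact mem_closedBall_zero_iff.1 (hsubset hw)

theorem sub_isBigO_of_fderiv_isBigO (hf : ∀ᶠ z in 𝓝 0, DifferentiableAt ℝ f z)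
    (hf' : fderiv ℝ f =O[𝓝 0] fun z => ‖z‖ ^ N) :
    (fun p : E × E => f p.1 - f p.2) =O[𝓝 0] fun p => ‖p‖ ^ N * ‖p.1 - p.2‖ := by
  obtain ⟨C, hC, hbound⟩ := hf'.exists_nonneg
  obtain ⟨ε, hε, hball⟩ := Metric.eventually_nhds_iff_ball.1 (hf.and hbound.bound)
  refine IsBigO.of_bound C ?_
  filter_upwards [Metric.ball_mem_nhds (0 : E × E) hε] with p hp
  have hsegment : ∀ w ∈ segment ℝ p.2 p.1, w ∈ Metric.ball 0 ε := fun w hw =>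
    mem_ball_zero_iff.2 ((norm_le_of_mem_segment hw).trans_lt (mem_ball_zero_iff.1 hp))
  have hmean := (convex_segment (𝕜 := ℝ) p.2 p.1).norm_image_sub_le_of_norm_fderiv_le (𝕜 := ℝ)
    (C := C * ‖p‖ ^ N) (fun w hw => (hball w (hsegment w hw)).1) ?_
    (left_mem_segment ℝ _ _) (right_mem_segment ℝ _ _)
  · simpa [mul_assoc] using hmean
  · intro w hw
    refine (hball w (hsegment w hw)).2.trans ?_
    rw [norm_pow, norm_norm]
    gcongr
    exact norm_le_of_mem_segment hw

theorem sub_sub_fderiv_isBigO_of_fderiv_fderiv_isBigO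
    (hf : ∀ᶠ z in 𝓝 0, DifferentiableAt ℝ f z)
    (hf' : ∀ᶠ z in 𝓝 0, DifferentiableAt ℝ (fderiv ℝ f) z)
    (hf'' : fderiv ℝ (fderiv ℝ f) =O[𝓝 0] fun z => ‖z‖ ^ N) :
    (fun p : E × E => f p.1 - f p.2 - fderiv ℝ f p.2 (p.1 - p.2)) =O[𝓝 0]
      fun p => ‖p‖ ^ N * ‖p.1 - p.2‖ ^ 2 := by
  obtain ⟨C, hC, hbound⟩ := (sub_isBigO_of_fderiv_isBigO hf' hf'').exists_nonneg
  obtain ⟨ε, hε, hball⟩ := Metric.eventually_nhds_iff_ball.1 hf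
  obtain ⟨ε', hε', hball'⟩ := Metric.eventually_nhds_iff_ball.1 hbound.bound
  refine IsBigO.of_bound C ?_
  filter_upwards [Metric.ball_mem_nhds (0 : E × E) (lt_min hε hε')] with p hp
  rw [mem_ball_zero_iff, lt_min_iff] at hp
  have hmean := (convex_segment (𝕜 := ℝ) p.2 p.1).norm_image_sub_le_of_norm_fderiv_le' (𝕜 := ℝ)
    (f := f) (φ := fderiv ℝ f p.2) (C := C * (‖p‖ ^ N * ‖p.1 - p.2‖))
    (fun w hw => hball w (mem_ball_zero_iff.2 ((norm_le_of_mem_segment hw).trans_lt hp.1))) ?_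
    (left_mem_segment ℝ _ _) (right_mem_segment ℝ _ _)
  · refine hmean.trans_eq ?_
    rw [Real.norm_of_nonneg (by positivity)]
    ring
  · intro w hw
    have hpair : ‖(w, p.2)‖ ≤ ‖p‖ := max_le (norm_le_of_mem_segment hw) (norm_snd_le p)
    refine (hball' (w, p.2) (mem_ball_zero_iff.2 (hpair.trans_lt hp.2))).trans ?_
    rw [Real.norm_of_nonneg (by positivity)]
    gcongr
    exact norm_sub_le_of_mem_segment hw

end MeanValue

namespace VanishesToInfiniteOrderAt

variable {E : Type*} [NormedAddCommGroup E] [NormedSpace ℝ E] {P : E → ℝ}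
  {X : Type*} {l : Filter X} {a b : X → E} {s : X → ℝ}

theorem iteratedFDeriv_isBigO_norm_pow (hflat : VanishesToInfiniteOrderAt P 0)
    (hP : ContDiffAt ℝ ∞ P 0) (n N : ℕ) :
    iteratedFDeriv ℝ n P =O[𝓝 0] fun z => ‖z‖ ^ N := by
  have hdiff : ∀ n : ℕ, ∀ᶠ z in 𝓝 0, DifferentiableAt ℝ (iteratedFDeriv ℝ n P) z := by
    intro n
    filter_upwards [(contDiffAt_infty.1 hP (n + 1)).eventually (by simp)] with z hz
    exact hz.differentiableAt_iteratedFDeriv (by exact_mod_cast n.lt_succ_self)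
  induction N generalizing n with
  | zero => simpa using (hdiff n).self_of_nhds.continuousAt.isBigO_one ℝ
  | succ N ih =>
    have hderiv : fderiv ℝ (iteratedFDeriv ℝ n P) =O[𝓝 0] fun z => ‖z‖ ^ N :=
      (isBigO_of_le _ fun _ => norm_fderiv_iteratedFDeriv.le).trans (ih (n + 1))
    have hpair : Tendsto (fun z : E => (z, (0 : E))) (𝓝 0) (𝓝 0) :=
      Continuous.tendsto' (by fun_prop) 0 0 rfl
    refine ((sub_isBigO_of_fderiv_isBigO (hdiff n) hderiv).comp_tendsto hpair).congr (fun z => ?_)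
      fun z => ?_
    · simp [hflat n]
    · simp [Prod.norm_def, pow_succ]

theorem isBigO_norm_pow (hflat : VanishesToInfiniteOrderAt P 0) (hP : ContDiffAt ℝ ∞ P 0)
    (N : ℕ) : P =O[𝓝 0] fun z => ‖z‖ ^ N :=
  (isBigO_of_le _ fun _ => norm_iteratedFDeriv_zero.ge).trans
    (hflat.iteratedFDeriv_isBigO_norm_pow hP 0 N)

theorem fderiv_isBigO_norm_pow (hflat : VanishesToInfiniteOrderAt P 0) (hP : ContDiffAt ℝ ∞ P 0)
    (N : ℕ) : fderiv ℝ P =O[𝓝 0] fun z => ‖z‖ ^ N :=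
  (isBigO_of_le _ fun _ => (norm_iteratedFDeriv_one P).ge).trans
    (hflat.iteratedFDeriv_isBigO_norm_pow hP 1 N)

theorem fderiv_fderiv_isBigO_norm_pow (hflat : VanishesToInfiniteOrderAt P 0)
    (hP : ContDiffAt ℝ ∞ P 0) (N : ℕ) : fderiv ℝ (fderiv ℝ P) =O[𝓝 0] fun z => ‖z‖ ^ N := by
  refine (isBigO_of_le _ fun z => le_of_eq ?_).trans (hflat.iteratedFDeriv_isBigO_norm_pow hP 2 N)
  rw [← norm_iteratedFDeriv_fderiv, norm_iteratedFDeriv_one]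

theorem sub_isBigO (hflat : VanishesToInfiniteOrderAt P 0) (hP : ContDiffAt ℝ ∞ P 0)
    (ha : a =O[l] s) (hb : b =O[l] s) (hs : Tendsto s l (𝓝 0)) (N : ℕ) :
    (fun x => P (a x) - P (b x)) =O[l] fun x => s x ^ N * ‖a x - b x‖ := by
  have hdiff : ∀ᶠ z in 𝓝 0, DifferentiableAt ℝ P z := by
    filter_upwards [(contDiffAt_infty.1 hP 1).eventually (by simp)] with z hz
    exact hz.differentiableAt (by simp)
  have hpair : (fun x => (a x, b x)) =O[l] s := ha.prod_left hb
  exact ((sub_isBigO_of_fderiv_isBigO hdiff (hflat.fderiv_isBigO_norm_pow hP N)).comp_tendsto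
    (hpair.trans_tendsto hs)).trans ((hpair.norm_left.pow N).mul (isBigO_refl _ _))

theorem sub_sub_fderiv_isBigO (hflat : VanishesToInfiniteOrderAt P 0) (hP : ContDiffAt ℝ ∞ P 0)
    (ha : a =O[l] s) (hb : b =O[l] s) (hs : Tendsto s l (𝓝 0)) (N : ℕ) :
    (fun x => P (a x) - P (b x) - fderiv ℝ P (b x) (a x - b x)) =O[l]
      fun x => s x ^ N * ‖a x - b x‖ ^ 2 := by
  have hsmooth : ∀ᶠ z in 𝓝 0, ContDiffAt ℝ 2 P z :=
    (contDiffAt_infty.1 hP 2).eventually (by simp)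
  have hpair : (fun x => (a x, b x)) =O[l] s := ha.prod_left hb
  have hremainder := sub_sub_fderiv_isBigO_of_fderiv_fderiv_isBigO
    (hsmooth.mono fun z hz => hz.differentiableAt (by simp))
    (hsmooth.mono fun z hz => (hz.fderiv_right (m := 1) (by norm_num)).differentiableAt (by simp))
    (hflat.fderiv_fderiv_isBigO_norm_pow hP N)
  exact (hremainder.comp_tendsto (hpair.trans_tendsto hs)).trans
    ((hpair.norm_left.pow N).mul (isBigO_refl _ _))

end VanishesToInfiniteOrderAt

/-! ### Radial flat functions -/

theorem not_eventually_exists_lt_le {p : ℝ → ℝ} (hcont : ∀ᶠ r in 𝓝[>] 0, ContinuousAt p r)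
    (hpos : ∀ᶠ r in 𝓝[>] 0, 0 < p r) (hlim : Tendsto p (𝓝[>] 0) (𝓝 0)) :
    ¬ ∀ᶠ r in 𝓝[>] 0, ∃ s, 0 < s ∧ s < r ∧ p r ≤ p s := by
  intro hdescent
  obtain ⟨ρ, hρ, hsub⟩ := mem_nhdsGT_iff_exists_Ioc_subset.1 ((hcont.and hpos).and hdescent)
  obtain ⟨δ, hδ, hsmall⟩ := mem_nhdsGT_iff_exists_Ioc_subset.1
    (hlim.eventually_lt_const (hsub (Set.right_mem_Ioc.2 hρ)).1.2)
  have hlarge : ∀ {r}, 0 < r → p ρ ≤ p r → δ < r := fun hr hle =>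
    not_le.1 fun hrδ => hle.not_gt (hsmall ⟨hr, hrδ⟩)
  have hcompact : IsCompact (Set.Icc δ ρ ∩ p ⁻¹' Set.Ici (p ρ)) := by
    refine isCompact_Icc.of_isClosed_subset (ContinuousOn.preimage_isClosed_of_isClosed
      (fun r hr => ?_) isClosed_Icc isClosed_Ici) Set.inter_subset_left
    exact (hsub ⟨lt_of_lt_of_le hδ hr.1, hr.2⟩).1.1.continuousWithinAt
  obtain ⟨s, ⟨hs, hρs⟩, hleast⟩ :=
    hcompact.exists_isLeast ⟨ρ, ⟨(hlarge hρ le_rfl).le, le_rfl⟩, le_refl (p ρ)⟩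
  obtain ⟨t, ht, hts, hst⟩ := (hsub ⟨lt_of_lt_of_le hδ hs.1, hs.2⟩).2
  have hρt : p ρ ≤ p t := le_trans hρs hst
  exact hts.not_ge (hleast ⟨⟨(hlarge ht hρt).le, hts.le.trans hs.2⟩, hρt⟩)

theorem exists_mem_Ioo_lt_of_hasDerivAt_neg {f : ℝ → ℝ} {f' a x : ℝ} (hf : HasDerivAt f f' x)
    (hf' : f' < 0) (hax : a < x) : ∃ s ∈ Set.Ioo a x, f x < f s := by
  have hslope := (hasDerivWithinAt_iff_tendsto_slope' Set.self_notMem_Iio).1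
    (hf.hasDerivWithinAt (s := Set.Iio x))
  obtain ⟨s, hs, hsa⟩ := ((hslope.eventually_lt_const hf').and (Ioo_mem_nhdsLT hax)).exists
  rw [slope_comm, slope_def_field, div_lt_iff₀ (sub_pos.2 hsa.2), zero_mul, sub_neg] at hs
  exact ⟨s, hsa, hs⟩

theorem exists_neBot_le_tendsto_atTop {X : Type*} {l : Filter X} {f : X → ℝ}
    (h : ∀ N : ℕ, ∃ᶠ x in l, (N : ℝ) ≤ f x) : ∃ l' ≤ l, l'.NeBot ∧ Tendsto f l' atTop := by
  refine ⟨l ⊓ comap f atTop, inf_le_left, ?_, tendsto_comap.mono_left inf_le_right⟩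
  refine inf_neBot_iff_frequently_right.2 fun hp => ?_
  obtain ⟨c, -, hc⟩ := (atTop_basis.comap f).eventually_iff.1 hp
  obtain ⟨N, hN⟩ := exists_nat_ge c
  exact (h N).mono fun x hx => hc (hN.trans hx)

theorem hasFDerivAt_norm {E : Type*} [NormedAddCommGroup E] [InnerProductSpace ℝ E] {x : E}
    (hx : x ≠ 0) : HasFDerivAt (fun y : E => ‖y‖) (‖x‖⁻¹ • innerSL ℝ x) x := by
  have hsqrt := (hasStrictFDerivAt_norm_sq x).hasFDerivAt.sqrt (by simpa using hx)
  simp only [Real.sqrt_sq (norm_nonneg _)] at hsqrt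
  convert hsqrt using 1
  module

/-- The logarithmic derivative `p' / p` of the profile `p` of the radial function `P = p ∘ ‖·‖`. -/
noncomputable def radialLogDeriv (P : ℂ → ℝ) (r : ℝ) : ℝ := fderiv ℝ P r 1 / P r

/-- Functions that are smooth near `0`, flat at `0`, radial, and positive off `0`. -/
structure IsRadialFlat (P : ℂ → ℝ) : Prop where
  smooth : ContDiffAt ℝ ∞ P 0
  flat : VanishesToInfiniteOrderAt P 0
  radial : ∀ᶠ z in 𝓝 (0 : ℂ), P z = P (‖z‖ : ℝ)
  pos : ∀ᶠ z in 𝓝 (0 : ℂ), z ≠ 0 → 0 < P z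

namespace IsRadialFlat

variable {P : ℂ → ℝ}

theorem map_zero (hP : IsRadialFlat P) : P 0 = 0 := by
  simpa using congrArg (fun m => m ![]) (hP.flat 0)

theorem tendsto_zero (hP : IsRadialFlat P) : Tendsto P (𝓝 0) (𝓝 0) := by
  simpa [hP.map_zero] using hP.smooth.continuousAt.tendsto

theorem isBigO_norm_pow (hP : IsRadialFlat P) (N : ℕ) : P =O[𝓝 0] fun z => ‖z‖ ^ N :=
  hP.flat.isBigO_norm_pow hP.smooth N

theorem eventually_differentiableAt (hP : IsRadialFlat P) :
    ∀ᶠ z in 𝓝 0, DifferentiableAt ℝ P z := by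
  filter_upwards [(contDiffAt_infty.1 hP.smooth 1).eventually (by simp)] with z hz
  exact hz.differentiableAt (by simp)

theorem eventually_pos (hP : IsRadialFlat P) : ∀ᶠ z in 𝓝[≠] (0 : ℂ), 0 < P z :=
  eventually_nhdsWithin_iff.2 hP.pos

theorem map_unit_mul (hP : IsRadialFlat P) :
    ∀ᶠ z in 𝓝 0, ∀ u : ℂ, ‖u‖ = 1 → P (u * z) = P z := by
  obtain ⟨ε, hε, hball⟩ := Metric.eventually_nhds_iff_ball.1 hP.radial
  filter_upwards [Metric.ball_mem_nhds (0 : ℂ) hε] with z hz u hu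
  rw [hball (u * z) (by simpa [hu] using hz), hball z hz, norm_mul, hu, one_mul]

theorem hasDerivAt_ofReal (hP : IsRadialFlat P) :
    ∀ᶠ r : ℝ in 𝓝[>] 0, HasDerivAt (fun r : ℝ => P r) (fderiv ℝ P r 1) r := by
  filter_upwards [tendsto_ofReal_zero.eventually hP.eventually_differentiableAt] with r hr
  exact hr.hasFDerivAt.comp_hasDerivAt r (Complex.ofRealCLM.hasDerivAt (x := r))

theorem fderiv_ray (hP : IsRadialFlat P) : ∀ᶠ r : ℝ in 𝓝[>] 0, ∀ u : ℂ, ‖u‖ = 1 →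
    fderiv ℝ P (r * u) = fderiv ℝ P r 1 • innerSL ℝ u := by
  obtain ⟨ε, hε, hball⟩ := Metric.eventually_nhds_iff_ball.1 hP.radial
  filter_upwards [hP.hasDerivAt_ofReal, Ioo_mem_nhdsGT hε] with r hderiv hr u hu
  have hnorm : ‖(r : ℂ) * u‖ = r := by rw [norm_mul, hu, mul_one, Complex.norm_of_nonneg hr.1.le]
  have hne : (r : ℂ) * u ≠ 0 := norm_pos_iff.1 (hnorm.symm ▸ hr.1)
  have hradial : P =ᶠ[𝓝 (r * u)] fun z => P (‖z‖ : ℝ) :=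
    (Metric.isOpen_ball.eventually_mem (mem_ball_zero_iff.2 (hnorm.symm ▸ hr.2))).mono hball
  have hcomp := (hnorm.symm ▸ hderiv :
    HasDerivAt (fun r : ℝ => P r) (fderiv ℝ P r 1) ‖(r : ℂ) * u‖).comp_hasFDerivAt _
    (hasFDerivAt_norm hne)
  rw [(hcomp.congr_of_eventuallyEq hradial).fderiv, hnorm, ← Complex.real_smul, map_smul,
    inv_smul_smul₀ hr.1.ne']

theorem tendsto_div_pow (hP : IsRadialFlat P) (N : ℕ) :
    Tendsto (fun r : ℝ => P r / r ^ N) (𝓝[>] 0) (𝓝 0) := by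
  have hpow := (hP.isBigO_norm_pow (N + 1)).comp_tendsto tendsto_ofReal_zero
  have hquot := hpow.mul (isBigO_refl (fun r : ℝ => (r ^ N)⁻¹) (𝓝[>] 0))
  refine hquot.trans_tendsto ((tendsto_id.mono_left nhdsWithin_le_nhds).congr' ?_)
  filter_upwards [self_mem_nhdsWithin] with r hr
  have hr : 0 < r := hr
  simp only [Function.comp_apply, Complex.norm_of_nonneg hr.le, id, pow_succ]
  field_simp

theorem frequently_natCast_le_mul_radialLogDeriv (hP : IsRadialFlat P) (N : ℕ) :
    ∃ᶠ r : ℝ in 𝓝[>] 0, (N : ℝ) ≤ r * radialLogDeriv P r := by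
  intro hlt
  have hpos := tendsto_ofReal_punctured.eventually hP.eventually_pos
  have hderiv : ∀ᶠ r : ℝ in 𝓝[>] 0, ∃ p', p' < 0 ∧
      HasDerivAt (fun r : ℝ => P r / r ^ (N + 1)) p' r := by
    filter_upwards [hlt, hpos, hP.hasDerivAt_ofReal, self_mem_nhdsWithin] with r hlt hPr hd hr
    have hr : 0 < r := hr
    refine ⟨_, div_neg_of_neg_of_pos ?_ (by positivity),
      hd.div (hasDerivAt_pow (N + 1) r) (by positivity)⟩
    rw [not_le, radialLogDeriv, ← mul_div_assoc, div_lt_iff₀ hPr] at hlt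
    have hfactor : fderiv ℝ P r 1 * r ^ (N + 1) - P r * (↑(N + 1) * r ^ (N + 1 - 1)) =
        r ^ N * (r * fderiv ℝ P r 1 - (N + 1) * P r) := by
      push_cast [Nat.add_sub_cancel]
      ring
    rw [hfactor]
    exact mul_neg_of_pos_of_neg (by positivity) (by linarith)
  refine not_eventually_exists_lt_le (p := fun r : ℝ => P r / r ^ (N + 1))
    (hderiv.mono fun r ⟨_, _, hd⟩ => hd.continuousAt) ?_ (hP.tendsto_div_pow _) ?_
  · filter_upwards [hpos, self_mem_nhdsWithin] with r hPr hr
    exact div_pos hPr (pow_pos hr _)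
  · filter_upwards [hderiv, self_mem_nhdsWithin] with r ⟨p', hp', hd⟩ hr
    obtain ⟨s, hs, hlt⟩ := exists_mem_Ioo_lt_of_hasDerivAt_neg hd hp' hr
    exact ⟨s, hs.1, hs.2, hlt.le⟩

end IsRadialFlat

theorem tendsto_norm_sub_div_pow {φ q : ℂ → ℂ} {k : ℕ} (hk : k ≠ 0) (hq : ContinuousAt q 0)
    (hφ : ∀ᶠ z in 𝓝 0, φ z = z + z ^ (k + 1) * q z) {u : ℂ} (hu : ‖u‖ = 1) :
    Tendsto (fun r : ℝ => (‖φ (r * u)‖ - r) / r ^ (k + 1)) (𝓝[>] 0) (𝓝 (q 0 * u ^ k).re) := by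
  have hnorm := (hasFDerivAt_norm (ne_zero_of_norm_eq_one hu)).hasFDerivWithinAt (s := Set.univ)
  have hremainder : Tendsto (fun r : ℝ => u ^ (k + 1) * q (r * u)) (𝓝[>] 0)
      (𝓝 (u ^ (k + 1) * q 0)) :=
    (hq.tendsto.comp (tendsto_ofReal_mul_zero u)).const_mul _
  have hpow : Tendsto (fun r : ℝ => r ^ k) (𝓝[>] 0) (𝓝 0) :=
    ((continuous_pow k).tendsto' 0 0 (zero_pow hk)).mono_left nhdsWithin_le_nhds
  have hlim := hnorm.lim (c := fun r : ℝ => (r ^ k)⁻¹)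
    (d := fun r : ℝ => r ^ k • (u ^ (k + 1) * q (r * u))) (v := u ^ (k + 1) * q 0)
    (by simpa using hpow.smul hremainder) (Eventually.of_forall fun _ => Set.mem_univ _)
    (hremainder.congr' ?_)
  · have hvalue : (‖u‖⁻¹ • innerSL ℝ u) (u ^ (k + 1) * q 0) = (q 0 * u ^ k).re := by
      have hconj : u * (starRingEnd ℂ) u = 1 := by
        simp [Complex.mul_conj, Complex.normSq_eq_norm_sq, hu]
      rw [hu, inv_one, one_smul, innerSL_apply_apply, Complex.inner]
      congr 1
      linear_combination q 0 * u ^ k * hconj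
    rw [hvalue] at hlim
    refine hlim.congr' ?_
    filter_upwards [(tendsto_ofReal_mul_zero u).eventually hφ, self_mem_nhdsWithin] with r hr hr0
    have hr0 : 0 < r := hr0
    have hfactor : φ (r * u) = (r : ℂ) * (u + r ^ k • (u ^ (k + 1) * q (r * u))) := by
      rw [hr, Complex.real_smul]
      push_cast
      ring
    rw [hfactor, norm_mul, Complex.norm_of_nonneg hr0.le, hu, smul_eq_mul]
    field_simp
    ring
  · filter_upwards [self_mem_nhdsWithin] with r hr
    exact (inv_smul_smul₀ (pow_ne_zero k (ne_of_gt hr)) _).symm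

theorem exists_unit_tendsto_norm_sub_div_pow {φ q : ℂ → ℂ} {k : ℕ} (hk : k ≠ 0)
    (hq : ContinuousAt q 0) (hq0 : q 0 ≠ 0) (hφ : ∀ᶠ z in 𝓝 0, φ z = z + z ^ (k + 1) * q z)
    {σ : ℝ} (hσ : |σ| = 1) : ∃ u : ℂ, ‖u‖ = 1 ∧
      Tendsto (fun r : ℝ => (‖φ (r * u)‖ - r) / r ^ (k + 1)) (𝓝[>] 0) (𝓝 (‖q 0‖ * σ)) := by
  obtain ⟨u, hu, hdir⟩ := exists_unit_mul_pow_eq (w := (σ : ℂ)) hq0 (by simpa using hσ) hk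
  refine ⟨u, hu, ?_⟩
  simpa only [hdir, ← Complex.ofReal_mul, Complex.ofReal_re] using
    tendsto_norm_sub_div_pow hk hq hφ hu

theorem frequently_norm_map_eq {φ q : ℂ → ℂ} {k : ℕ} (hk : k ≠ 0)
    (hq : ContinuousAt q 0) (hq0 : q 0 ≠ 0) (hφ : ∀ᶠ z in 𝓝 0, φ z = z + z ^ (k + 1) * q z)
    (hcont : ∀ᶠ z in 𝓝 0, ContinuousAt φ z) : ∃ᶠ z in 𝓝[≠] (0 : ℂ), ‖φ z‖ = ‖z‖ := by
  have hpos : 0 < ‖q 0‖ := norm_pos_iff.2 hq0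
  obtain ⟨u, hu, hin⟩ := exists_unit_tendsto_norm_sub_div_pow hk hq hq0 hφ (σ := -1) (by simp)
  obtain ⟨v, hv, hout⟩ := exists_unit_tendsto_norm_sub_div_pow hk hq hq0 hφ (σ := 1) (by simp)
  intro hne
  obtain ⟨ε, hε, hball⟩ := Metric.eventually_nhds_iff_ball.1
    ((eventually_nhdsWithin_iff.1 hne).and hcont)
  obtain ⟨r, ⟨hru, hrv⟩, hr0, hrε⟩ := (((hin.eventually_lt_const (by linarith : _ < (0 : ℝ))).and
    (hout.eventually_const_lt (by linarith : (0 : ℝ) < _))).and (Ioo_mem_nhdsGT hε)).exists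
  have hsphere : ∀ z ∈ Metric.sphere (0 : ℂ) r, z ∈ Metric.ball (0 : ℂ) ε := fun z hz => by
    rw [mem_ball_zero_iff, mem_sphere_zero_iff_norm.1 hz]
    exact hrε
  have hpre : IsPreconnected (Metric.sphere (0 : ℂ) r) :=
    isPreconnected_sphere (by simp [Complex.rank_real_complex]) 0 r
  rw [div_lt_iff₀ (pow_pos hr0 _), zero_mul, sub_neg] at hru
  rw [lt_div_iff₀ (pow_pos hr0 _), zero_mul, sub_pos] at hrv
  obtain ⟨z, hz, hzr⟩ := hpre.intermediate_value (a := r * u) (b := r * v)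
    (by simp [hu, hr0.le]) (by simp [hv, hr0.le])
    (fun z hz => (hball z (hsphere z hz)).2.norm.continuousWithinAt) ⟨hru.le, hrv.le⟩
  have hzr' : ‖z‖ = r := mem_sphere_zero_iff_norm.1 hz
  exact (hball z (hsphere z hz)).1 (norm_pos_iff.1 (hzr'.symm ▸ hr0)) (hzr.trans hzr'.symm)

namespace IsRadialFlat

variable {P : ℂ → ℝ}

theorem not_eventually_weighted_le (hP : IsRadialFlat P) {w : ℝ → ℝ}
    (hw : ∀ᶠ r in 𝓝[>] 0, ContinuousAt w r) (hw0 : ∀ᶠ r in 𝓝[>] 0, 0 < w r)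
    (hlim : Tendsto (fun r : ℝ => P r * w r) (𝓝[>] 0) (𝓝 0)) :
    ¬ ∀ᶠ r : ℝ in 𝓝[>] 0, ∃ s : ℝ, 0 < s ∧ s < r ∧ P r * w r ≤ P s * w s := by
  refine not_eventually_exists_lt_le ?_ ?_ hlim
  · filter_upwards [hP.hasDerivAt_ofReal, hw] with r hr hwr
    exact hr.continuousAt.mul hwr
  · filter_upwards [tendsto_ofReal_punctured.eventually hP.eventually_pos, hw0] with r hr hwr
    exact mul_pos hr hwr

theorem one_le_norm_deriv (hP : IsRadialFlat P) {φ : ℂ → ℂ} {φ' : ℂ} {a : ℝ} (ha : 0 < a)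
    (hφ : HasDerivAt φ φ' 0) (hφ0 : φ 0 = 0)
    (hratio : Tendsto (fun z => P (φ z) / P z) (𝓝[≠] 0) (𝓝 a)) : 1 ≤ ‖φ'‖ := by
  by_contra! hlt
  obtain ⟨c, hφ'c, hc1⟩ := exists_between hlt
  obtain ⟨N, hN⟩ := exists_pow_lt_of_lt_one (half_pos ha) hc1
  have hφlim : Tendsto φ (𝓝 0) (𝓝 0) := by simpa [hφ0] using hφ.continuousAt.tendsto
  have hslope : ∀ᶠ z in 𝓝[≠] 0, ‖φ z‖ / ‖z‖ < c := by
    filter_upwards [(hasDerivAt_iff_tendsto_slope.1 hφ).norm.eventually_lt_const hφ'c] with z hz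
    simpa [slope_def_field, hφ0] using hz
  refine hP.not_eventually_weighted_le (w := fun r => (r ^ N)⁻¹) ?_ ?_ (hP.tendsto_div_pow N) ?_
  · filter_upwards [self_mem_nhdsWithin] with r hr
    exact (continuousAt_id.pow N).inv₀ (pow_ne_zero N (ne_of_gt hr))
  · filter_upwards [self_mem_nhdsWithin] with r hr using inv_pos.2 (pow_pos hr N)
  filter_upwards [tendsto_ofReal_punctured.eventually hslope,
    tendsto_ofReal_punctured.eventually (hratio.eventually_const_lt (half_lt_self ha)),
    tendsto_ofReal_punctured.eventually hP.eventually_pos,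
    tendsto_ofReal_zero.eventually (hφlim.eventually hP.radial),
    self_mem_nhdsWithin] with r hslope hratio hPr hradial hr
  have hr : 0 < r := hr
  rw [Complex.norm_of_nonneg hr.le, div_lt_iff₀ hr] at hslope
  rw [lt_div_iff₀ hPr] at hratio
  have hne : φ r ≠ 0 := fun h0 => by
    rw [h0, hP.map_zero] at hratio
    exact hratio.not_gt (mul_pos (half_pos ha) hPr)
  have hφr : 0 < ‖φ r‖ := norm_pos_iff.2 hne
  refine ⟨‖φ r‖, hφr, hslope.trans (mul_lt_of_lt_one_left hr hc1), ?_⟩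
  rw [← hradial, ← div_eq_mul_inv, ← div_eq_mul_inv, div_le_div_iff₀ (pow_pos hr N) (pow_pos hφr N)]
  calc P r * ‖φ r‖ ^ N ≤ P r * (c * r) ^ N := by gcongr
    _ = c ^ N * (P r * r ^ N) := by ring
    _ ≤ a / 2 * (P r * r ^ N) := by gcongr
    _ = a / 2 * P r * r ^ N := by ring
    _ ≤ P (φ r) * r ^ N := by gcongr

theorem norm_deriv_eq_one (hP : IsRadialFlat P) {φ : ℂ → ℂ} {φ' : ℂ} {a : ℝ} (ha : 0 < a)
    (hφ : HasStrictDerivAt φ φ' 0) (hφ0 : φ 0 = 0)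
    (hratio : Tendsto (fun z => P (φ z) / P z) (𝓝[≠] 0) (𝓝 a)) : ‖φ'‖ = 1 := by
  have hle : 1 ≤ ‖φ'‖ := hP.one_le_norm_deriv ha hφ.hasDerivAt hφ0 hratio
  have hφ'0 : φ' ≠ 0 := norm_pos_iff.1 (one_pos.trans_le hle)
  set ψ := hφ.localInverse φ φ' 0 hφ'0
  have hψ : HasDerivAt ψ φ'⁻¹ 0 := by simpa [hφ0] using (hφ.to_localInverse hφ'0).hasDerivAt
  have hright : ∀ᶠ z in 𝓝 0, φ (ψ z) = z := by
    simpa [hφ0] using (hφ.hasStrictFDerivAt_equiv hφ'0).eventually_right_inverse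
  have hψ0 : ψ 0 = 0 := by
    simpa [hφ0] using (hφ.hasStrictFDerivAt_equiv hφ'0).localInverse_apply_image
  have hψpunctured : Tendsto ψ (𝓝[≠] 0) (𝓝[≠] 0) := by
    simpa [hψ0] using hψ.tendsto_nhdsNE (inv_ne_zero hφ'0)
  have hratio' : Tendsto (fun z => P (ψ z) / P z) (𝓝[≠] 0) (𝓝 a⁻¹) := by
    refine ((hratio.comp hψpunctured).inv₀ ha.ne').congr' ?_
    filter_upwards [hright.filter_mono nhdsWithin_le_nhds] with z hz
    rw [Function.comp_apply, hz, inv_div]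
  have hge := hP.one_le_norm_deriv (inv_pos.2 ha) hψ hψ0 hratio'
  rw [norm_inv, one_le_inv₀ (norm_pos_iff.2 hφ'0)] at hge
  exact hge.antisymm hle

theorem not_eventually_inward (hP : IsRadialFlat P) {C κ : ℝ} (hC : 0 ≤ C) (hκ : 0 < κ) {m : ℕ}
    (hm : m ≠ 0) : ¬ ∀ᶠ r : ℝ in 𝓝[>] 0, ∃ s, 0 < s ∧ s ≤ r - κ * r ^ m ∧
      (1 - C * r ^ m) * P r ≤ P s := by
  intro hinward
  have hcont : Continuous fun r => Real.exp (-(2 * C / κ * r)) := by fun_prop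
  refine hP.not_eventually_weighted_le (w := fun r => Real.exp (-(2 * C / κ * r)))
    (Eventually.of_forall fun _ => hcont.continuousAt)
    (Eventually.of_forall fun _ => Real.exp_pos _) ?_ ?_
  · simpa using (hP.tendsto_zero.comp tendsto_ofReal_zero).mul
      (hcont.continuousAt.tendsto.mono_left nhdsWithin_le_nhds)
  have hsmall : Tendsto (fun r : ℝ => C * r ^ m) (𝓝[>] 0) (𝓝 0) :=
    (Continuous.tendsto' (by fun_prop) 0 0 (by simp [hm])).mono_left nhdsWithin_le_nhds
  filter_upwards [hinward, hsmall.eventually_lt_const one_half_pos,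
    tendsto_ofReal_punctured.eventually hP.eventually_pos, self_mem_nhdsWithin]
    with r ⟨s, hs, hsr, hle⟩ hx hPr hr
  have hrm : 0 < r ^ m := pow_pos hr m
  refine ⟨s, hs, by linarith [mul_pos hκ hrm], ?_⟩
  have hexp : 1 + 2 * (C * r ^ m) ≤ Real.exp (2 * C / κ * (r - s)) := by
    have hgap : 2 * C / κ * (κ * r ^ m) ≤ 2 * C / κ * (r - s) := by gcongr; linarith
    rw [← mul_assoc, div_mul_cancel₀ _ hκ.ne', mul_assoc] at hgap
    linarith [Real.add_one_le_exp (2 * C / κ * (r - s))]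
  have hone : 1 ≤ (1 - C * r ^ m) * (1 + 2 * (C * r ^ m)) := by nlinarith [mul_nonneg hC hrm.le]
  calc P r * Real.exp (-(2 * C / κ * r))
      ≤ (1 - C * r ^ m) * (1 + 2 * (C * r ^ m)) * (P r * Real.exp (-(2 * C / κ * r))) :=
        le_mul_of_one_le_left (by positivity) hone
    _ = (1 - C * r ^ m) * P r * ((1 + 2 * (C * r ^ m)) * Real.exp (-(2 * C / κ * r))) := by ring
    _ ≤ P s * (Real.exp (2 * C / κ * (r - s)) * Real.exp (-(2 * C / κ * r))) := by
        gcongr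
        exact (mul_pos (by linarith) hPr).le.trans hle
    _ = P s * Real.exp (-(2 * C / κ * s)) := by
        rw [← Real.exp_add]
        ring_nf

theorem ratio_limit_eq_one (hP : IsRadialFlat P) {φ : ℂ → ℂ} {a : ℝ}
    (hφ : Tendsto φ (𝓝 0) (𝓝 0)) (hnorm : ∃ᶠ z in 𝓝[≠] (0 : ℂ), ‖φ z‖ = ‖z‖)
    (hratio : Tendsto (fun z => P (φ z) / P z) (𝓝[≠] 0) (𝓝 a)) : a = 1 := by
  by_contra hne
  refine hnorm ?_
  filter_upwards [hratio.eventually_ne hne, hP.eventually_pos,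
    (hφ.eventually hP.radial).filter_mono nhdsWithin_le_nhds,
    hP.radial.filter_mono nhdsWithin_le_nhds] with z hz hPz hradφ hrad hnorm
  exact hz (by rw [hradφ, hnorm, ← hrad, div_self hPz.ne'])

theorem not_ratio_sub_isBigO (hP : IsRadialFlat P) {φ q : ℂ → ℂ} {k : ℕ} (hk : k ≠ 0)
    (hq : ContinuousAt q 0) (hq0 : q 0 ≠ 0) (hφ : ∀ᶠ z in 𝓝 0, φ z = z + z ^ (k + 1) * q z)
    (hcont : ∀ᶠ z in 𝓝 0, ContinuousAt φ z) (a : ℝ) :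
    ¬ (fun z => P (φ z) / P z - a) =O[𝓝[≠] 0] fun z => ‖z‖ ^ (k + 1) := by
  intro hbound
  have hφlim : Tendsto φ (𝓝 0) (𝓝 0) := by
    simpa [hφ.self_of_nhds] using hcont.self_of_nhds.tendsto
  have hratio : Tendsto (fun z => P (φ z) / P z) (𝓝[≠] 0) (𝓝 a) := by
    have hpow : Tendsto (fun z : ℂ => ‖z‖ ^ (k + 1)) (𝓝[≠] 0) (𝓝 0) :=
      ((continuous_norm.pow _).tendsto' 0 0 (by simp)).mono_left nhdsWithin_le_nhds
    simpa using (hbound.trans_tendsto hpow).add_const a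
  obtain rfl := hP.ratio_limit_eq_one hφlim (frequently_norm_map_eq hk hq hq0 hφ hcont) hratio
  obtain ⟨C, hC, hCbound⟩ := hbound.exists_pos
  have hpos : 0 < ‖q 0‖ := norm_pos_iff.2 hq0
  obtain ⟨u, hu, hin⟩ := exists_unit_tendsto_norm_sub_div_pow hk hq hq0 hφ (σ := -1) (by simp)
  have hray := tendsto_ofReal_mul_punctured (ne_zero_of_norm_eq_one hu)
  have hmod : ∀ᶠ z in 𝓝[≠] (0 : ℂ), P (φ z) = P (‖φ z‖ : ℝ) ∧ P z = P (‖z‖ : ℝ) :=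
    ((hφlim.eventually hP.radial).and hP.radial).filter_mono nhdsWithin_le_nhds
  refine hP.not_eventually_inward hC.le (half_pos hpos) (Nat.add_one_ne_zero k) ?_
  filter_upwards [hin.eventually_lt_const (by linarith : _ < -(‖q 0‖ / 2)),
    hray.eventually hCbound.bound, hray.eventually hP.eventually_pos, hray.eventually hmod,
    hray.eventually (hratio.eventually_const_lt one_pos), self_mem_nhdsWithin]
    with r hlt hle hPr ⟨hradφ, hrad⟩ hratio_pos hr
  have hr : 0 < r := hr
  have hnorm : ‖(r : ℂ) * u‖ = r := by rw [norm_mul, hu, mul_one, Complex.norm_of_nonneg hr.le]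
  rw [div_lt_iff₀ (pow_pos hr _)] at hlt
  rw [hnorm, norm_pow, Real.norm_of_nonneg hr.le] at hle
  rw [hnorm] at hrad
  refine ⟨‖φ (r * u)‖, norm_pos_iff.2 fun h0 => ?_, by linarith, ?_⟩
  · simp [h0, hP.map_zero] at hratio_pos
  · rw [← hradφ, ← hrad, ← le_div_iff₀ hPr]
    linarith [(abs_le.1 hle).1]

end IsRadialFlat

/-! ### The hypersurface and its self-maps -/

theorem isBigO_re_self {X : Type*} (f : X → ℂ) (l : Filter X) : (fun x => (f x).re) =O[l] f :=
  isBigO_of_le _ fun _ => Complex.abs_re_le_norm _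

theorem isBigO_im_self {X : Type*} (f : X → ℂ) (l : Filter X) : (fun x => (f x).im) =O[l] f :=
  isBigO_of_le _ fun _ => Complex.abs_im_le_norm _

theorem isBigO_ofReal_self {X : Type*} (f : X → ℝ) (l : Filter X) :
    (fun x => (f x : ℂ)) =O[l] f :=
  Complex.isBigO_ofReal_left.2 (isBigO_refl f l)

/-- The defining function `Re z₁ + P(z₂) + Im z₁ · Q(z₂, Im z₁)` of the hypersurface. -/
def graphFunction (P : ℂ → ℝ) (Q : ℂ → ℝ → ℝ) (z : ℂ × ℂ) : ℝ :=
  z.1.re + P z.2 + z.1.im * Q z.2 z.1.im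

/-- The germs at `0` of the functions `P` and `Q` (the coupling term) that define a hypersurface
of the kind considered here. Of the smoothness of `Q` only the Lipschitz bound is recorded. -/
structure IsModelGerm (P : ℂ → ℝ) (Q : ℂ → ℝ → ℝ) : Prop extends IsRadialFlat P where
  coupling_zero : Q 0 0 = 0
  coupling_lipschitz : (fun p : (ℂ × ℝ) × (ℂ × ℝ) => Q p.1.1 p.1.2 - Q p.2.1 p.2.2) =O[𝓝 0]
    fun p => p.1 - p.2
  coupling_radial : ∀ᶠ x : ℂ × ℝ in 𝓝 0, Q x.1 x.2 = Q (‖x.1‖ : ℝ) x.2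

/-- The ratio `z₁ / P(z₂)` at the point `graphPoint P Q τ z₂`. -/
noncomputable def graphSlope (P : ℂ → ℝ) (Q : ℂ → ℝ → ℝ) (τ : ℝ) (z : ℂ) : ℂ :=
  -1 + τ * (Complex.I - Q z (τ * P z))

/-- The point of the hypersurface over `z₂ = z` with `Im z₁ = τ P(z)`. -/
noncomputable def graphPoint (P : ℂ → ℝ) (Q : ℂ → ℝ → ℝ) (τ : ℝ) (z : ℂ) : ℂ × ℂ :=
  (P z * graphSlope P Q τ z, z)

section GraphPoint

variable (P : ℂ → ℝ) (Q : ℂ → ℝ → ℝ) (τ : ℝ) (z : ℂ)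

theorem graphPoint_fst_re :
    (graphPoint P Q τ z).1.re = -P z - τ * P z * Q z (τ * P z) := by
  simp only [graphPoint, graphSlope, Complex.re_ofReal_mul, Complex.add_re, Complex.neg_re,
    Complex.one_re, Complex.sub_re, Complex.I_re, Complex.ofReal_re]
  ring

theorem graphPoint_fst_im : (graphPoint P Q τ z).1.im = τ * P z := by
  simp only [graphPoint, graphSlope, Complex.im_ofReal_mul, Complex.add_im, Complex.neg_im,
    Complex.one_im, Complex.sub_im, Complex.I_im, Complex.ofReal_im]
  ring

theorem graphFunction_graphPoint : graphFunction P Q (graphPoint P Q τ z) = 0 := by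
  rw [graphFunction, graphPoint_fst_re, graphPoint_fst_im, graphPoint]
  ring

end GraphPoint

namespace IsModelGerm

variable {P : ℂ → ℝ} {Q : ℂ → ℝ → ℝ}

section Coupling

variable {X : Type*} {l : Filter X} {a b : X → ℂ} {s t : X → ℝ}

theorem coupling_sub_isBigO (h : IsModelGerm P Q) (ha : Tendsto a l (𝓝 0))
    (hb : Tendsto b l (𝓝 0)) (hs : Tendsto s l (𝓝 0)) (ht : Tendsto t l (𝓝 0)) :
    (fun x => Q (a x) (s x) - Q (b x) (t x)) =O[l] fun x => ‖a x - b x‖ + ‖s x - t x‖ := by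
  have hlim : Tendsto (fun x => ((a x, s x), (b x, t x))) l (𝓝 0) :=
    (ha.prodMk_nhds hs).prodMk_nhds (hb.prodMk_nhds ht)
  refine (h.coupling_lipschitz.comp_tendsto hlim).trans (isBigO_of_le _ fun x => ?_)
  rw [Real.norm_of_nonneg (by positivity)]
  exact max_le_add_of_nonneg (norm_nonneg _) (norm_nonneg _)

theorem tendsto_coupling (h : IsModelGerm P Q) (ha : Tendsto a l (𝓝 0))
    (hs : Tendsto s l (𝓝 0)) : Tendsto (fun x => Q (a x) (s x)) l (𝓝 0) := by
  have hdiff := h.coupling_sub_isBigO ha tendsto_const_nhds hs tendsto_const_nhds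
  simp only [h.coupling_zero, sub_zero] at hdiff
  exact hdiff.trans_tendsto (by simpa using ha.norm.add hs.norm)

end Coupling

theorem graphFunction_unit_mul (h : IsModelGerm P Q) :
    ∀ᶠ z : ℂ × ℂ in 𝓝 0, ∀ u : ℂ, ‖u‖ = 1 →
      graphFunction P Q (z.1, u * z.2) = graphFunction P Q z := by
  obtain ⟨ε, hε, hball⟩ := Metric.eventually_nhds_iff_ball.1 h.coupling_radial
  filter_upwards [tendsto_snd_zero.eventually h.map_unit_mul, Metric.ball_mem_nhds 0 hε]
    with z hP hz u hu
  rw [mem_ball_zero_iff, norm_lt_iff] at hz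
  have hmem : ∀ w : ℂ, ‖w‖ = ‖z.2‖ → (w, z.1.im) ∈ Metric.ball (0 : ℂ × ℝ) ε := fun w hw => by
    rw [mem_ball_zero_iff, Prod.norm_def, max_lt_iff]
    exact ⟨hw.trans_lt hz.2, (Complex.abs_im_le_norm z.1).trans_lt hz.1⟩
  have hnorm : ‖u * z.2‖ = ‖z.2‖ := by rw [norm_mul, hu, one_mul]
  have hQ : Q (u * z.2) z.1.im = Q z.2 z.1.im := by
    rw [hball _ (hmem _ hnorm), hball _ (hmem z.2 rfl), hnorm]
  simp only [graphFunction, hP u hu, hQ]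

theorem tendsto_mul (h : IsModelGerm P Q) (τ : ℝ) :
    Tendsto (fun z => τ * P z) (𝓝 0) (𝓝 0) := by
  simpa using h.tendsto_zero.const_mul τ

theorem tendsto_graphSlope (h : IsModelGerm P Q) (τ : ℝ) :
    Tendsto (graphSlope P Q τ) (𝓝 0) (𝓝 (-1 + τ * Complex.I)) := by
  have hQ := (Complex.continuous_ofReal.tendsto 0).comp
    (h.tendsto_coupling tendsto_id (h.tendsto_mul τ))
  rw [Complex.ofReal_zero] at hQ
  unfold graphSlope
  simpa using ((hQ.const_sub Complex.I).const_mul (τ : ℂ)).const_add (-1)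

theorem graphPoint_fst_isBigO (h : IsModelGerm P Q) (τ : ℝ) :
    (fun z => (graphPoint P Q τ z).1) =O[𝓝 0] P := by
  simpa [graphPoint] using
    (isBigO_ofReal_self P (𝓝 0)).mul ((h.tendsto_graphSlope τ).isBigO_one ℝ)

theorem tendsto_graphPoint (h : IsModelGerm P Q) (τ : ℝ) :
    Tendsto (graphPoint P Q τ) (𝓝 0) (𝓝 0) :=
  ((h.graphPoint_fst_isBigO τ).trans_tendsto h.tendsto_zero).prodMk_nhds tendsto_id

theorem graphPoint_isBigO (h : IsModelGerm P Q) (τ : ℝ) :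
    graphPoint P Q τ =O[𝓝 0] fun z => ‖z‖ :=
  ((h.graphPoint_fst_isBigO τ).trans (by simpa using h.isBigO_norm_pow 1)).prod_left
    (isBigO_refl (fun z : ℂ => z) _).norm_right

theorem comp_graphPoint_sub_isBigO (h : IsModelGerm P Q) (τ : ℝ) {F : ℂ × ℂ → ℂ}
    (hF : AnalyticAt ℂ F 0) {n : ℕ} (hlow : ∀ m < n, ∀ᶠ w in 𝓝 0, fstCoeff F m w = 0) :
    (fun z => F (graphPoint P Q τ z) - (P z * graphSlope P Q τ z) ^ n * fstCoeff F n z) =O[𝓝 0]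
      fun z => P z ^ (n + 1) :=
  ((sub_pow_mul_fstCoeff_isBigO hF hlow).comp_tendsto (h.tendsto_graphPoint τ)).trans
    ((h.graphPoint_fst_isBigO τ).norm_left.pow (n + 1))

theorem sq_isBigO (h : IsModelGerm P Q) (N : ℕ) :
    (fun z => P z ^ 2) =O[𝓝 0] fun z => P z * ‖z‖ ^ N := by
  simpa only [sq] using (isBigO_refl P (𝓝 0)).mul (h.isBigO_norm_pow N)

end IsModelGerm

/-- `(F₁, F₂)` is a holomorphic germ fixing the origin and mapping the hypersurface to itself. -/
structure IsModelSelfMap (P : ℂ → ℝ) (Q : ℂ → ℝ → ℝ) (F₁ F₂ : ℂ × ℂ → ℂ) : Prop extends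
    IsModelGerm P Q where
  analytic₁ : AnalyticAt ℂ F₁ 0
  analytic₂ : AnalyticAt ℂ F₂ 0
  map_zero₁ : F₁ 0 = 0
  map_zero₂ : F₂ 0 = 0
  maps : ∀ᶠ z in 𝓝 (0 : ℂ × ℂ), graphFunction P Q z = 0 → graphFunction P Q (F₁ z, F₂ z) = 0

namespace IsModelSelfMap

variable {P : ℂ → ℝ} {Q : ℂ → ℝ → ℝ} {F₁ F₂ : ℂ × ℂ → ℂ}

theorem graphFunction_map_graphPoint (hF : IsModelSelfMap P Q F₁ F₂) (τ : ℝ) :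
    ∀ᶠ z in 𝓝 (0 : ℂ),
      graphFunction P Q (F₁ (graphPoint P Q τ z), F₂ (graphPoint P Q τ z)) = 0 := by
  filter_upwards [(hF.tendsto_graphPoint τ).eventually hF.maps] with z hz
  exact hz (graphFunction_graphPoint P Q τ z)

theorem tendsto_fst_graphPoint (hF : IsModelSelfMap P Q F₁ F₂) (τ : ℝ) :
    Tendsto (fun z => F₁ (graphPoint P Q τ z)) (𝓝 0) (𝓝 0) := by
  have hlim := hF.analytic₁.continuousAt.tendsto
  rw [hF.map_zero₁] at hlim
  exact hlim.comp (hF.tendsto_graphPoint τ)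

theorem tendsto_im_fst_graphPoint (hF : IsModelSelfMap P Q F₁ F₂) (τ : ℝ) :
    Tendsto (fun z => (F₁ (graphPoint P Q τ z)).im) (𝓝 0) (𝓝 0) :=
  (Complex.continuous_im.tendsto' 0 0 rfl).comp (hF.tendsto_fst_graphPoint τ)

theorem snd_graphPoint_isBigO (hF : IsModelSelfMap P Q F₁ F₂) (τ : ℝ) :
    (fun z => F₂ (graphPoint P Q τ z)) =O[𝓝 0] fun z => ‖z‖ := by
  have hbound := hF.analytic₂.differentiableAt.isBigO_sub
  simp only [hF.map_zero₂, sub_zero] at hbound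
  exact (hbound.comp_tendsto (hF.tendsto_graphPoint τ)).trans (hF.graphPoint_isBigO τ)

theorem tendsto_snd_graphPoint (hF : IsModelSelfMap P Q F₁ F₂) (τ : ℝ) :
    Tendsto (fun z => F₂ (graphPoint P Q τ z)) (𝓝 0) (𝓝 0) :=
  (hF.snd_graphPoint_isBigO τ).trans_tendsto tendsto_norm_zero

theorem tendsto_coupling_graphPoint (hF : IsModelSelfMap P Q F₁ F₂) (τ : ℝ) :
    Tendsto (fun z => Q (F₂ (graphPoint P Q τ z)) (F₁ (graphPoint P Q τ z)).im) (𝓝 0) (𝓝 0) :=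
  hF.tendsto_coupling (hF.tendsto_snd_graphPoint τ) (hF.tendsto_im_fst_graphPoint τ)

theorem eventually_fst_zero (hF : IsModelSelfMap P Q F₁ F₂) :
    ∀ᶠ w in 𝓝 (0 : ℂ), F₁ (0, w) = 0 := by
  have hanalytic := analyticAt_zero_left hF.analytic₁
  refine eventually_eq_zero_of_isBigO_norm_pow hanalytic fun N => ?_
  have hq := hF.tendsto_coupling_graphPoint 0
  refine isBigO_norm_pow_of_re_add_im_mul hanalytic hF.map_zero₁
    (hq.mono_left nhdsWithin_le_nhds) (IsBigO.mono ?_ nhdsWithin_le_nhds)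
  have hfst : (fun z => F₁ (graphPoint P Q 0 z) - F₁ (0, z)) =O[𝓝 0] fun z => ‖z‖ ^ N := by
    have hcoeff := hF.comp_graphPoint_sub_isBigO 0 hF.analytic₁ (n := 0) (by simp)
    simp only [pow_zero, one_mul, fstCoeff_zero, zero_add, pow_one] at hcoeff
    exact hcoeff.trans (hF.isBigO_norm_pow N)
  have hsnd : (fun z => P (F₂ (graphPoint P Q 0 z))) =O[𝓝 0] fun z => ‖z‖ ^ N :=
    ((hF.isBigO_norm_pow N).comp_tendsto (hF.tendsto_snd_graphPoint 0)).trans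
      ((hF.snd_graphPoint_isBigO 0).norm_left.pow N)
  have him := ((isBigO_im_self _ _).trans hfst).mul (hq.isBigO_one ℝ)
  simp only [mul_one] at him
  refine ((hsnd.add ((isBigO_re_self _ _).trans hfst)).add him).neg_left.congr' ?_ EventuallyEq.rfl
  filter_upwards [hF.graphFunction_map_graphPoint 0] with z hz
  simp only [graphFunction] at hz
  simp only [Complex.sub_re, Complex.sub_im]
  linear_combination -hz

/-! ### The invariance equation to first order in `P` -/

theorem snd_zero_isBigO (hF : IsModelSelfMap P Q F₁ F₂) :
    (fun z : ℂ => F₂ (0, z)) =O[𝓝 0] fun z => ‖z‖ := by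
  have hbound := (analyticAt_zero_left hF.analytic₂).differentiableAt.isBigO_sub
  rw [show F₂ (0, (0 : ℂ)) = 0 from hF.map_zero₂] at hbound
  simpa using hbound.norm_right

theorem tendsto_snd_zero_left (hF : IsModelSelfMap P Q F₁ F₂) :
    Tendsto (fun z : ℂ => F₂ (0, z)) (𝓝 0) (𝓝 0) :=
  hF.snd_zero_isBigO.trans_tendsto tendsto_norm_zero

theorem tendsto_coupling_snd_zero (hF : IsModelSelfMap P Q F₁ F₂) :
    Tendsto (fun z => Q (F₂ (0, z)) 0) (𝓝 0) (𝓝 0) :=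
  hF.tendsto_coupling hF.tendsto_snd_zero_left tendsto_const_nhds

theorem fst_graphPoint_isBigO (hF : IsModelSelfMap P Q F₁ F₂) (τ : ℝ) :
    (fun z => F₁ (graphPoint P Q τ z)) =O[𝓝 0] P := by
  have hcoeff := hF.comp_graphPoint_sub_isBigO τ hF.analytic₁ (n := 0) (by simp)
  simp only [pow_zero, one_mul, fstCoeff_zero, zero_add, pow_one] at hcoeff
  refine hcoeff.congr' ?_ EventuallyEq.rfl
  filter_upwards [hF.eventually_fst_zero] with z hz
  rw [hz, sub_zero]

theorem fst_graphPoint_sub_isBigO (hF : IsModelSelfMap P Q F₁ F₂) (τ : ℝ) :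
    (fun z => F₁ (graphPoint P Q τ z) - P z * (graphSlope P Q τ z * fstCoeff F₁ 1 z)) =O[𝓝 0]
      fun z => P z ^ 2 := by
  refine (hF.comp_graphPoint_sub_isBigO τ hF.analytic₁ (n := 1) fun m hm => ?_).congr_left
    fun z => by rw [pow_one, mul_assoc]
  obtain rfl : m = 0 := by omega
  simpa using hF.eventually_fst_zero

theorem snd_graphPoint_sub_isBigO (hF : IsModelSelfMap P Q F₁ F₂) (τ : ℝ) :
    (fun z => F₂ (graphPoint P Q τ z) - F₂ (0, z)) =O[𝓝 0] P := by
  simpa using hF.comp_graphPoint_sub_isBigO τ hF.analytic₂ (n := 0) (by simp)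

theorem coupling_graphPoint_sub_isBigO (hF : IsModelSelfMap P Q F₁ F₂) (τ : ℝ) :
    (fun z => Q (F₂ (graphPoint P Q τ z)) (F₁ (graphPoint P Q τ z)).im - Q (F₂ (0, z)) 0)
      =O[𝓝 0] P := by
  refine (hF.coupling_sub_isBigO (hF.tendsto_snd_graphPoint τ) hF.tendsto_snd_zero_left
    (hF.tendsto_im_fst_graphPoint τ) tendsto_const_nhds).trans ?_
  refine (hF.snd_graphPoint_sub_isBigO τ).norm_left.add ?_
  simpa using (isBigO_im_self _ _).trans (hF.fst_graphPoint_isBigO τ)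

theorem snd_comp_graphPoint_sub_isBigO (hF : IsModelSelfMap P Q F₁ F₂) (τ : ℝ) (N : ℕ) :
    (fun z => P (F₂ (graphPoint P Q τ z)) - P (F₂ (0, z))) =O[𝓝 0] fun z => P z * ‖z‖ ^ N := by
  refine (hF.flat.sub_isBigO hF.smooth (hF.snd_graphPoint_isBigO τ) hF.snd_zero_isBigO
    tendsto_norm_zero N).trans ?_
  simpa only [mul_comm] using (isBigO_refl (fun z : ℂ => ‖z‖ ^ N) (𝓝 0)).mul
    (hF.snd_graphPoint_sub_isBigO τ).norm_left

theorem first_order_isBigO (hF : IsModelSelfMap P Q F₁ F₂) (τ : ℝ) (N : ℕ) :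
    (fun z => P z * ((graphSlope P Q τ z * fstCoeff F₁ 1 z).re +
      (graphSlope P Q τ z * fstCoeff F₁ 1 z).im * Q (F₂ (0, z)) 0) + P (F₂ (0, z))) =O[𝓝 0]
      fun z => P z * ‖z‖ ^ N := by
  have hfst := hF.fst_graphPoint_sub_isBigO τ
  have hre := (isBigO_re_self _ _).trans hfst
  have him := ((isBigO_im_self _ _).trans hfst).mul (hF.tendsto_coupling_snd_zero.isBigO_one ℝ)
  have hcoupling := ((isBigO_im_self _ _).trans (hF.fst_graphPoint_isBigO τ)).mul
    (hF.coupling_graphPoint_sub_isBigO τ)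
  simp only [mul_one] at him
  simp only [← sq] at hcoupling
  refine ((((hre.add him).add hcoupling).trans (hF.sq_isBigO N)).add
    (hF.snd_comp_graphPoint_sub_isBigO τ N)).neg_left.congr' ?_ EventuallyEq.rfl
  filter_upwards [hF.graphFunction_map_graphPoint τ] with z hz
  simp only [graphFunction] at hz
  simp only [Complex.sub_re, Complex.sub_im, Complex.re_ofReal_mul, Complex.im_ofReal_mul]
  linear_combination -hz

theorem first_order_div_isBigO (hF : IsModelSelfMap P Q F₁ F₂) (τ : ℝ) (N : ℕ) :
    (fun z => (graphSlope P Q τ z * fstCoeff F₁ 1 z).re +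
      (graphSlope P Q τ z * fstCoeff F₁ 1 z).im * Q (F₂ (0, z)) 0 + P (F₂ (0, z)) / P z)
      =O[𝓝[≠] 0] fun z => ‖z‖ ^ N := by
  refine (((hF.first_order_isBigO τ N).mono nhdsWithin_le_nhds).mul
    (isBigO_refl (fun z => (P z)⁻¹) (𝓝[≠] 0))).congr' ?_ ?_ <;>
    filter_upwards [hF.eventually_pos] with z hz using by field_simp

theorem ratio_sub_isBigO (hF : IsModelSelfMap P Q F₁ F₂) (N : ℕ) :
    (fun z => P (F₂ (0, z)) / P z - ((fstCoeff F₁ 1 z).re +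
      (fstCoeff F₁ 1 z).im * Q (F₂ (0, z)) 0)) =O[𝓝[≠] 0] fun z => ‖z‖ ^ N := by
  refine (hF.first_order_div_isBigO 0 N).congr_left fun z => ?_
  simp only [graphSlope, Complex.ofReal_zero, zero_mul, add_zero, neg_one_mul, Complex.neg_re,
    Complex.neg_im]
  ring

theorem im_fstCoeff_isBigO (hF : IsModelSelfMap P Q F₁ F₂) (N : ℕ) :
    (fun z => (fstCoeff F₁ 1 z).im * (1 + Q z (P z) * Q (F₂ (0, z)) 0) -
      (fstCoeff F₁ 1 z).re * (Q (F₂ (0, z)) 0 - Q z (P z))) =O[𝓝[≠] 0] fun z => ‖z‖ ^ N := by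
  refine ((hF.first_order_div_isBigO 0 N).sub (hF.first_order_div_isBigO 1 N)).congr_left
    fun z => ?_
  simp [graphSlope]
  ring

theorem tendsto_re_fstCoeff (hF : IsModelSelfMap P Q F₁ F₂) :
    Tendsto (fun z => (fstCoeff F₁ 1 z).re) (𝓝[≠] 0) (𝓝 (fstCoeff F₁ 1 0).re) :=
  (Complex.continuous_re.continuousAt.comp
    (analyticAt_fstCoeff hF.analytic₁ 1).continuousAt).tendsto.mono_left nhdsWithin_le_nhds

theorem tendsto_im_fstCoeff (hF : IsModelSelfMap P Q F₁ F₂) :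
    Tendsto (fun z => (fstCoeff F₁ 1 z).im) (𝓝[≠] 0) (𝓝 (fstCoeff F₁ 1 0).im) :=
  (Complex.continuous_im.continuousAt.comp
    (analyticAt_fstCoeff hF.analytic₁ 1).continuousAt).tendsto.mono_left nhdsWithin_le_nhds

theorem tendsto_coupling_punctured (hF : IsModelSelfMap P Q F₁ F₂) :
    Tendsto (fun z => Q z (P z)) (𝓝[≠] 0) (𝓝 0) ∧
      Tendsto (fun z => Q (F₂ (0, z)) 0) (𝓝[≠] 0) (𝓝 0) :=
  ⟨(hF.tendsto_coupling tendsto_id hF.tendsto_zero).mono_left nhdsWithin_le_nhds,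
    hF.tendsto_coupling_snd_zero.mono_left nhdsWithin_le_nhds⟩

theorem im_fstCoeff_one_zero (hF : IsModelSelfMap P Q F₁ F₂) : (fstCoeff F₁ 1 0).im = 0 := by
  obtain ⟨hQ, hQφ⟩ := hF.tendsto_coupling_punctured
  have hlim := (hF.tendsto_im_fstCoeff.mul ((hQ.mul hQφ).const_add 1)).sub
    (hF.tendsto_re_fstCoeff.mul (hQφ.sub hQ))
  have hzero := (hF.im_fstCoeff_isBigO 1).trans_tendsto
    (by simpa using tendsto_norm_zero.mono_left nhdsWithin_le_nhds)
  simpa using tendsto_nhds_unique hlim hzero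

theorem tendsto_ratio (hF : IsModelSelfMap P Q F₁ F₂) :
    Tendsto (fun z => P (F₂ (0, z)) / P z) (𝓝[≠] 0) (𝓝 (fstCoeff F₁ 1 0).re) := by
  have hzero := (hF.ratio_sub_isBigO 1).trans_tendsto
    (by simpa using tendsto_norm_zero.mono_left nhdsWithin_le_nhds)
  simpa using hzero.add
    (hF.tendsto_re_fstCoeff.add (hF.tendsto_im_fstCoeff.mul hF.tendsto_coupling_punctured.2))

theorem re_fstCoeff_pos (hF : IsModelSelfMap P Q F₁ F₂) (hne : fstCoeff F₁ 1 0 ≠ 0) :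
    0 < (fstCoeff F₁ 1 0).re := by
  have hnonneg : ∀ᶠ w in 𝓝 (0 : ℂ), 0 ≤ P w := by
    filter_upwards [hF.pos] with w hw
    rcases eq_or_ne w 0 with rfl | hw0
    · exact hF.map_zero.ge
    · exact (hw hw0).le
  have hre : 0 ≤ (fstCoeff F₁ 1 0).re := by
    refine ge_of_tendsto hF.tendsto_ratio ?_
    filter_upwards [hnonneg.filter_mono nhdsWithin_le_nhds,
      (hF.tendsto_snd_zero_left.eventually hnonneg).filter_mono nhdsWithin_le_nhds] with z hz hφz
    exact div_nonneg hφz hz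
  exact hre.lt_of_ne fun h0 => hne (Complex.ext h0.symm hF.im_fstCoeff_one_zero)

theorem norm_deriv_snd_eq_one (hF : IsModelSelfMap P Q F₁ F₂) (hne : fstCoeff F₁ 1 0 ≠ 0) :
    ‖deriv (fun w : ℂ => F₂ (0, w)) 0‖ = 1 :=
  hF.norm_deriv_eq_one (hF.re_fstCoeff_pos hne) (analyticAt_zero_left hF.analytic₂).hasStrictDerivAt
    hF.map_zero₂ hF.tendsto_ratio

theorem fstCoeff_one_sub_isBigO (hF : IsModelSelfMap P Q F₁ F₂) {m : ℕ}
    (hm : (fun z : ℂ => F₂ (0, z) - z) =O[𝓝 0] fun z => ‖z‖ ^ m) :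
    (fun z => fstCoeff F₁ 1 z - fstCoeff F₁ 1 0) =O[𝓝 0] fun z => ‖z‖ ^ m := by
  obtain ⟨hQ, hQφ⟩ := hF.tendsto_coupling_punctured
  have hQsub : (fun z => Q (F₂ (0, z)) 0 - Q z (P z)) =O[𝓝 0] fun z => ‖z‖ ^ m := by
    refine (hF.coupling_sub_isBigO hF.tendsto_snd_zero_left tendsto_id tendsto_const_nhds
      hF.tendsto_zero).trans (hm.norm_left.add ?_)
    simpa using hF.isBigO_norm_pow m
  have hunit : Tendsto (fun z => 1 + Q z (P z) * Q (F₂ (0, z)) 0) (𝓝[≠] 0) (𝓝 1) := by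
    simpa using (hQ.mul hQφ).const_add 1
  have him : (fun z => (fstCoeff F₁ 1 z).im) =O[𝓝[≠] 0] fun z => ‖z‖ ^ m := by
    have hre := (hF.tendsto_re_fstCoeff.isBigO_one ℝ).mul (hQsub.mono nhdsWithin_le_nhds)
    simp only [one_mul] at hre
    have hquot := ((hF.im_fstCoeff_isBigO m).add hre).mul
      ((hunit.inv₀ one_ne_zero).isBigO_one ℝ)
    simp only [mul_one] at hquot
    refine hquot.congr' ?_ EventuallyEq.rfl
    filter_upwards [hunit.eventually_ne one_ne_zero] with z hz
    rw [sub_add_cancel, mul_assoc, mul_inv_cancel₀ hz, mul_one]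
  have hanalytic : AnalyticAt ℂ (fun z => -Complex.I * (fstCoeff F₁ 1 z - fstCoeff F₁ 1 0)) 0 :=
    analyticAt_const.mul ((analyticAt_fstCoeff hF.analytic₁ 1).sub analyticAt_const)
  have hrotated := isBigO_norm_pow_of_re_add_im_mul hanalytic (q := fun _ => 0) (n := m)
    (by simp) tendsto_const_nhds (him.congr_left fun z => by simp [hF.im_fstCoeff_one_zero])
  simpa [← mul_assoc] using hrotated.const_mul_left Complex.I

theorem ratio_sub_const_isBigO (hF : IsModelSelfMap P Q F₁ F₂) {m : ℕ}
    (hm : (fun z : ℂ => F₂ (0, z) - z) =O[𝓝 0] fun z => ‖z‖ ^ m) :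
    (fun z => P (F₂ (0, z)) / P z - (fstCoeff F₁ 1 0).re) =O[𝓝[≠] 0] fun z => ‖z‖ ^ m := by
  have hcoeff := (hF.fstCoeff_one_sub_isBigO hm).mono (nhdsWithin_le_nhds (s := {0}ᶜ))
  have hre := (isBigO_re_self _ _).trans hcoeff
  have him := ((isBigO_im_self _ _).trans hcoeff).mul
    (hF.tendsto_coupling_punctured.2.isBigO_one ℝ)
  simp only [mul_one] at him
  refine (((hF.ratio_sub_isBigO m).add hre).add him).congr_left fun z => ?_
  rw [Complex.sub_re, Complex.sub_im, hF.im_fstCoeff_one_zero]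
  ring

theorem eventually_snd_eq (hF : IsModelSelfMap P Q F₁ F₂)
    (hderiv : deriv (fun w : ℂ => F₂ (0, w)) 0 = 1) : ∀ᶠ w in 𝓝 (0 : ℂ), F₂ (0, w) = w := by
  have hφ := analyticAt_zero_left hF.analytic₂
  by_contra hne
  obtain ⟨q, k, hk, hq, hq0, hφq⟩ := exists_eq_add_pow_mul hφ hF.map_zero₂ hderiv hne
  have hbound : (fun z : ℂ => F₂ (0, z) - z) =O[𝓝 0] fun z => ‖z‖ ^ (k + 1) := by
    have hpow : (fun z : ℂ => z ^ (k + 1)) =O[𝓝 0] fun z => ‖z‖ ^ (k + 1) :=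
      isBigO_of_le _ fun z => by simp
    have hmul := hpow.mul (hq.isBigO_one ℝ)
    simp only [mul_one] at hmul
    refine hmul.congr' ?_ EventuallyEq.rfl
    filter_upwards [hφq] with z hz
    rw [hz, add_sub_cancel_left]
  exact hF.not_ratio_sub_isBigO hk hq hq0 hφq
    (hφ.eventually_analyticAt.mono fun _ hz => hz.continuousAt) _ (hF.ratio_sub_const_isBigO hbound)

theorem eventually_fstCoeff_one_eq (hF : IsModelSelfMap P Q F₁ F₂)
    (hderiv : deriv (fun w : ℂ => F₂ (0, w)) 0 = 1) :
    ∀ᶠ w in 𝓝 (0 : ℂ), fstCoeff F₁ 1 w = 1 := by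
  have hsnd := hF.eventually_snd_eq hderiv
  have hconst : ∀ᶠ w in 𝓝 (0 : ℂ), fstCoeff F₁ 1 w - fstCoeff F₁ 1 0 = 0 := by
    refine eventually_eq_zero_of_isBigO_norm_pow
      ((analyticAt_fstCoeff hF.analytic₁ 1).sub analyticAt_const) fun N =>
      hF.fstCoeff_one_sub_isBigO ((isBigO_zero _ _).congr' ?_ EventuallyEq.rfl)
    filter_upwards [hsnd] with w hw
    rw [hw, sub_self]
  have hre : (fstCoeff F₁ 1 0).re = 1 := by
    refine tendsto_nhds_unique (hF.tendsto_ratio.congr' ?_) tendsto_const_nhds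
    filter_upwards [hF.eventually_pos, hsnd.filter_mono nhdsWithin_le_nhds] with z hPz hz
    rw [hz, div_self hPz.ne']
  have hone : fstCoeff F₁ 1 0 = 1 := Complex.ext hre hF.im_fstCoeff_one_zero
  filter_upwards [hconst] with w hw
  rw [sub_eq_zero.1 hw, hone]

end IsModelSelfMap

/-! ### Tangency to the identity of higher order -/

section Interpolation

open Polynomial

theorem isLittleO_eval_of_degree_lt {ι κ 𝕜 : Type*} [NormedField 𝕜]
    {l : Filter ι} {G : ι → ℝ} {f : ι → 𝕜[X]} {s : Finset κ} {v : κ → 𝕜} (hv : Set.InjOn v s)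
    (hdeg : ∀ x, (f x).degree < s.card) (h : ∀ i ∈ s, (fun x => (f x).eval (v i)) =o[l] G)
    (a : 𝕜) : (fun x => (f x).eval a) =o[l] G := by
  classical
  have hsum : ∀ x, ∑ i ∈ s, (Lagrange.basis s v i).eval a * (f x).eval (v i) = (f x).eval a :=
    fun x => by
      conv_rhs => rw [Lagrange.eq_interpolate hv (hdeg x), Lagrange.interpolate_apply]
      simp [eval_finsetSum, mul_comm]
  exact (IsLittleO.fun_sum fun i hi => (h i hi).const_mul_left _).congr_left hsum

/-- The polynomial in `s` whose value at `s = iτ` with `τ` real is `2 Re (ξʲ (ξ A + B))`,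
where `ξ = -1 + iτ`. -/
noncomputable def twiceRePolynomial (j : ℕ) (A B : ℂ) : ℂ[X] :=
  (X - 1) ^ j * ((X - 1) * C A + C B) +
    (-X - 1) ^ j * ((-X - 1) * C (star A) + C (star B))

theorem twiceRePolynomial_degree_lt (j : ℕ) (A B : ℂ) :
    (twiceRePolynomial j A B).degree < ((j + 2 : ℕ) : WithBot ℕ) := by
  have hsummand : ∀ (p : ℂ[X]) (a b : ℂ), p.natDegree ≤ 1 →
      (p ^ j * (p * C a + C b)).natDegree ≤ j + 1 := fun p a b hp =>
    natDegree_mul_le_of_le (by simpa using natDegree_pow_le_of_le j hp)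
      (natDegree_add_le_of_degree_le ((natDegree_mul_C_le _ _).trans hp) (by simp))
  refine (degree_le_of_natDegree_le (natDegree_add_le_of_degree_le
    (hsummand _ _ _ ?_) (hsummand _ _ _ ?_))).trans_lt (by exact_mod_cast (j + 1).lt_succ_self)
  all_goals compute_degree

theorem twiceRePolynomial_eval_mul_I (j : ℕ) (A B : ℂ) (τ : ℝ) :
    (twiceRePolynomial j A B).eval (τ * Complex.I) =
      ((2 * ((-1 + τ * Complex.I) ^ j * ((-1 + τ * Complex.I) * A + B)).re : ℝ) : ℂ) := by
  rw [← Complex.add_conj]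
  simp only [twiceRePolynomial, eval_add, eval_mul, eval_pow, eval_sub, eval_neg, eval_X, eval_one,
    eval_C, map_mul, map_pow, map_add, map_neg, map_one, Complex.conj_ofReal, Complex.conj_I,
    Complex.star_def]
  ring

theorem twiceRePolynomial_eval_one {j : ℕ} (hj : j ≠ 0) (A B : ℂ) :
    (twiceRePolynomial j A B).eval 1 = (-2) ^ j * star (B - 2 * A) := by
  simp only [twiceRePolynomial, eval_add, eval_mul, eval_pow, eval_sub, eval_neg, eval_X, eval_one,
    eval_C, sub_self, zero_pow hj, star_sub, star_mul', star_ofNat]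
  ring

theorem sub_two_mul_isLittleO {ι : Type*} {l : Filter ι} {A B : ι → ℂ} {G : ι → ℝ} {j : ℕ}
    (hj : j ≠ 0) (h : ∀ τ : ℝ, (fun x => ((-1 + τ * Complex.I) ^ j *
      ((-1 + τ * Complex.I) * A x + B x)).re) =o[l] G) :
    (fun x => B x - 2 * A x) =o[l] G := by
  have hv : Set.InjOn (fun n : ℕ => ((n : ℝ) : ℂ) * Complex.I) (Finset.range (j + 2)) :=
    fun a _ b _ hab => by simpa using hab
  have heval := isLittleO_eval_of_degree_lt (f := fun x => twiceRePolynomial j (A x) (B x)) hv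
    (fun x => by simpa only [Finset.card_range] using twiceRePolynomial_degree_lt j (A x) (B x))
    (G := G) (l := l) (fun n _ => by
      simp only [twiceRePolynomial_eval_mul_I]
      exact Complex.isLittleO_ofReal_left.2 ((h n).const_mul_left 2)) 1
  simp only [twiceRePolynomial_eval_one hj] at heval
  refine IsLittleO.of_norm_left (((isLittleO_const_mul_left_iff
    (pow_ne_zero j (by norm_num : (-2 : ℂ) ≠ 0))).1 heval).norm_left.congr_left fun x =>
      norm_star _)

end Interpolation

theorem exists_norm_pow_isBigO {g : ℂ → ℂ} (hg : AnalyticAt ℂ g 0)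
    (hne : ¬ ∀ᶠ z in 𝓝 0, g z = 0) : ∃ K : ℕ, (fun z => ‖z‖ ^ K) =O[𝓝 0] g := by
  obtain ⟨K, q, hq, hq0, hgq⟩ := exists_eventually_eq_pow_mul hg hne
  refine ⟨K, ?_⟩
  have hinv := (hq.continuousAt.tendsto.inv₀ hq0).isBigO_one ℝ
  have hmul := (isBigO_refl g (𝓝 0)).norm_right.mul hinv
  simp only [mul_one] at hmul
  refine (IsBigO.congr' hmul.norm_left ?_ EventuallyEq.rfl).of_norm_right
  filter_upwards [hgq, hq.continuousAt.eventually_ne hq0] with z hz hqz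
  rw [hz, mul_inv_cancel_right₀ hqz, norm_pow]

/-- An error scale `G` along the filter `l`, fine enough to detect the leading coefficients `α` and
`β` of the two components of a map tangent to the identity; `P' β` and `P α` enter the invariance
equation at the same order. -/
structure IsGauge (P : ℂ → ℝ) (α β : ℂ → ℂ) (l : Filter ℂ) (G : ℂ → ℝ) : Prop where
  le : l ≤ 𝓝[≠] 0
  fst_isBigO : α =O[l] G
  fderiv_mul_snd_isBigO : (fun z => ‖fderiv ℝ P z‖ * ‖β z‖) =O[l] fun z => P z * G z
  snd_isLittleO : β =o[l] G
  exists_pow_isLittleO : ∃ N : ℕ, (fun z => ‖z‖ ^ N) =o[l] G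

theorem IsRadialFlat.isGauge {P : ℂ → ℝ} {α β : ℂ → ℂ} {l : Filter ℂ} (hP : IsRadialFlat P)
    (hα : AnalyticAt ℂ α 0) (hβ : AnalyticAt ℂ β 0)
    (hne : ¬ ((∀ᶠ z in 𝓝 0, α z = 0) ∧ ∀ᶠ z in 𝓝 0, β z = 0)) (hl : l ≤ 𝓝[≠] 0)
    (hL : Tendsto (fun z => ‖fderiv ℝ P z‖ / P z) l atTop) :
    IsGauge P α β l fun z => ‖α z‖ + ‖fderiv ℝ P z‖ / P z * ‖β z‖ := by
  have hpos : ∀ᶠ z in l, 0 < P z := hl hP.eventually_pos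
  have hl0 : l ≤ 𝓝 0 := hl.trans nhdsWithin_le_nhds
  have hfst : α =O[l] fun z => ‖α z‖ + ‖fderiv ℝ P z‖ / P z * ‖β z‖ := by
    refine IsBigO.of_norm_eventuallyLE ?_
    filter_upwards [hpos] with z hz
    exact le_add_of_nonneg_right (by positivity)
  have hlog : (fun z => ‖fderiv ℝ P z‖ / P z * ‖β z‖) =O[l]
      fun z => ‖α z‖ + ‖fderiv ℝ P z‖ / P z * ‖β z‖ := by
    refine IsBigO.of_norm_eventuallyLE ?_
    filter_upwards [hpos] with z hz
    rw [Real.norm_of_nonneg (by positivity)]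
    exact le_add_of_nonneg_left (norm_nonneg _)
  have hsnd : β =o[l] fun z => ‖α z‖ + ‖fderiv ℝ P z‖ / P z * ‖β z‖ := by
    have hmul := ((isLittleO_one_iff ℝ).2 hL.inv_tendsto_atTop).mul_isBigO hlog
    simp only [one_mul] at hmul
    refine IsLittleO.of_norm_left (hmul.congr' ?_ EventuallyEq.rfl)
    filter_upwards [hL.eventually_gt_atTop 0] with z hz
    exact inv_mul_cancel_left₀ hz.ne' _
  refine ⟨hl, hfst, ?_, hsnd, ?_⟩
  · refine ((isBigO_refl P l).mul hlog).congr' ?_ EventuallyEq.rfl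
    filter_upwards [hpos] with z hz
    field_simp
  · obtain ⟨K, hK⟩ : ∃ K : ℕ, (fun z => ‖z‖ ^ K) =O[l]
        fun z => ‖α z‖ + ‖fderiv ℝ P z‖ / P z * ‖β z‖ := by
      rcases not_and_or.1 hne with hα0 | hβ0
      · exact (exists_norm_pow_isBigO hα hα0).imp fun K hK => (hK.mono hl0).trans hfst
      · exact (exists_norm_pow_isBigO hβ hβ0).imp fun K hK => (hK.mono hl0).trans hsnd.isBigO
    exact ⟨K + 1, (((isLittleO_pow_pow K.lt_succ_self).comp_tendsto tendsto_norm_zero).mono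
      hl0).trans_isBigO hK⟩

namespace IsModelGerm

variable {P : ℂ → ℝ} {Q : ℂ → ℝ → ℝ}

theorem graphSlope_pow_sub_isLittleO (h : IsModelGerm P Q) (τ : ℝ) (n : ℕ) :
    (fun z => graphSlope P Q τ z ^ n - (-1 + τ * Complex.I) ^ n) =o[𝓝 0] fun _ => (1 : ℝ) :=
  (isLittleO_one_iff ℝ).2 (tendsto_sub_nhds_zero_iff.2 ((h.tendsto_graphSlope τ).pow n))

theorem comp_graphPoint_isBigO (h : IsModelGerm P Q) (τ : ℝ) {F : ℂ × ℂ → ℂ}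
    (hF : AnalyticAt ℂ F 0) {n : ℕ} (hlow : ∀ m < n, ∀ᶠ w in 𝓝 0, fstCoeff F m w = 0) :
    (fun z => F (graphPoint P Q τ z)) =O[𝓝 0] fun z => P z ^ n := by
  have hmain := (((isBigO_ofReal_self P (𝓝 0)).pow n).mul
    (((h.tendsto_graphSlope τ).pow n).isBigO_one ℝ)).mul
      ((analyticAt_fstCoeff hF n).continuousAt.isBigO_one ℝ)
  have hrem := (h.comp_graphPoint_sub_isBigO τ hF hlow).trans
    ((isBigO_refl (fun z => P z ^ n) (𝓝 0)).mul (h.tendsto_zero.isBigO_one ℝ))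
  simp only [mul_one] at hmain hrem
  refine (hrem.add hmain).congr_left fun z => ?_
  rw [mul_pow, sub_add_cancel]

end IsModelGerm

namespace IsGauge

variable {P : ℂ → ℝ} {α β : ℂ → ℂ} {l : Filter ℂ} {G : ℂ → ℝ}

theorem le_nhds (hG : IsGauge P α β l G) : l ≤ 𝓝 0 :=
  hG.le.trans nhdsWithin_le_nhds

theorem self_isLittleO (hG : IsGauge P α β l G) (hP : IsRadialFlat P) : P =o[l] G := by
  obtain ⟨N, hN⟩ := hG.exists_pow_isLittleO
  exact ((hP.isBigO_norm_pow N).mono hG.le_nhds).trans_isLittleO hN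

theorem fderiv_isLittleO (hG : IsGauge P α β l G) (hP : IsRadialFlat P) :
    fderiv ℝ P =o[l] G := by
  obtain ⟨N, hN⟩ := hG.exists_pow_isLittleO
  exact ((hP.flat.fderiv_isBigO_norm_pow hP.smooth N).mono hG.le_nhds).trans_isLittleO hN

end IsGauge

theorem IsModelGerm.comp_graphPoint_sub_isLittleO {P : ℂ → ℝ} {Q : ℂ → ℝ → ℝ}
    (h : IsModelGerm P Q) (τ : ℝ) {F : ℂ × ℂ → ℂ} (hF : AnalyticAt ℂ F 0) {n : ℕ}
    (hlow : ∀ m < n, ∀ᶠ w in 𝓝 0, fstCoeff F m w = 0) {l : Filter ℂ} (hl : l ≤ 𝓝 0) {G : ℂ → ℝ}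
    (hPG : P =o[l] G) (hcoeff : fstCoeff F n =O[l] G) :
    (fun z => F (graphPoint P Q τ z) - (P z * (-1 + τ * Complex.I)) ^ n * fstCoeff F n z) =o[l]
      fun z => P z ^ n * G z := by
  have hpow := isBigO_refl (fun z => P z ^ n) l
  have hrem : (fun z => F (graphPoint P Q τ z) - (P z * graphSlope P Q τ z) ^ n * fstCoeff F n z)
      =o[l] fun z => P z ^ n * G z :=
    ((h.comp_graphPoint_sub_isBigO τ hF hlow).mono hl).trans_isLittleO (by
      simpa only [pow_succ] using hpow.mul_isLittleO hPG)
  have hslope := (((isBigO_ofReal_self P l).pow n).mul_isLittleO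
    ((h.graphSlope_pow_sub_isLittleO τ n).mono hl)).mul_isBigO hcoeff
  simp only [mul_one] at hslope
  refine (hrem.add hslope).congr_left fun z => ?_
  simp only [mul_pow]
  ring

/-- `F₁ - z₁` vanishes to order `j + 1` and `F₂ - z₂` to order `j` along `z₁ = 0`. -/
structure IsTangentToIdentity (P : ℂ → ℝ) (Q : ℂ → ℝ → ℝ) (F₁ F₂ : ℂ × ℂ → ℂ) (j : ℕ) : Prop
    extends IsModelSelfMap P Q F₁ F₂ where
  fst_eq_zero : ∀ m < j + 1, ∀ᶠ w in 𝓝 0, fstCoeff (fun z => F₁ z - z.1) m w = 0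
  snd_eq_zero : ∀ m < j, ∀ᶠ w in 𝓝 0, fstCoeff (fun z => F₂ z - z.2) m w = 0

namespace IsModelSelfMap

variable {P : ℂ → ℝ} {Q : ℂ → ℝ → ℝ} {F₁ F₂ : ℂ × ℂ → ℂ}

theorem analyticAt_fst_sub (hF : IsModelSelfMap P Q F₁ F₂) :
    AnalyticAt ℂ (fun z : ℂ × ℂ => F₁ z - z.1) 0 :=
  hF.analytic₁.sub analyticAt_fst

theorem analyticAt_snd_sub (hF : IsModelSelfMap P Q F₁ F₂) :
    AnalyticAt ℂ (fun z : ℂ × ℂ => F₂ z - z.2) 0 :=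
  hF.analytic₂.sub analyticAt_snd

theorem graphFunction_map_graphPoint_sub (hF : IsModelSelfMap P Q F₁ F₂) (τ : ℝ) :
    ∀ᶠ z in 𝓝 (0 : ℂ),
      (F₁ (graphPoint P Q τ z) - (graphPoint P Q τ z).1).re + (P (F₂ (graphPoint P Q τ z)) - P z) +
        (F₁ (graphPoint P Q τ z) - (graphPoint P Q τ z).1).im *
          Q (F₂ (graphPoint P Q τ z)) (F₁ (graphPoint P Q τ z)).im +
        τ * P z * (Q (F₂ (graphPoint P Q τ z)) (F₁ (graphPoint P Q τ z)).im -
          Q z (τ * P z)) = 0 := by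
  filter_upwards [hF.graphFunction_map_graphPoint τ] with z hz
  rw [graphFunction] at hz
  rw [Complex.sub_re, Complex.sub_im, graphPoint_fst_re, graphPoint_fst_im]
  linear_combination hz

end IsModelSelfMap

/-- The coefficient of `z₁ʲ⁺¹` in `F₁ - z₁`, as a function of `z₂`. -/
noncomputable def fstLeadingCoeff (F₁ : ℂ × ℂ → ℂ) (j : ℕ) : ℂ → ℂ :=
  fstCoeff (fun z => F₁ z - z.1) (j + 1)

/-- The coefficient of `z₁ʲ` in `F₂ - z₂`, as a function of `z₂`. -/
noncomputable def sndLeadingCoeff (F₂ : ℂ × ℂ → ℂ) (j : ℕ) : ℂ → ℂ :=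
  fstCoeff (fun z => F₂ z - z.2) j

section LeadingCoeff

variable {P : ℂ → ℝ} {Q : ℂ → ℝ → ℝ} {F₁ F₂ : ℂ × ℂ → ℂ}

theorem IsModelSelfMap.analyticAt_fstLeadingCoeff (hF : IsModelSelfMap P Q F₁ F₂) (j : ℕ) :
    AnalyticAt ℂ (fstLeadingCoeff F₁ j) 0 :=
  analyticAt_fstCoeff hF.analyticAt_fst_sub (j + 1)

theorem IsModelSelfMap.analyticAt_sndLeadingCoeff (hF : IsModelSelfMap P Q F₁ F₂) (j : ℕ) :
    AnalyticAt ℂ (sndLeadingCoeff F₂ j) 0 :=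
  analyticAt_fstCoeff hF.analyticAt_snd_sub j

end LeadingCoeff

namespace IsTangentToIdentity

variable {P : ℂ → ℝ} {Q : ℂ → ℝ → ℝ} {F₁ F₂ : ℂ × ℂ → ℂ} {j : ℕ}

theorem fst_graphPoint_sub_isBigO (hF : IsTangentToIdentity P Q F₁ F₂ j) (τ : ℝ) :
    (fun z => F₁ (graphPoint P Q τ z) - (graphPoint P Q τ z).1) =O[𝓝 0] fun z => P z ^ (j + 1) :=
  hF.comp_graphPoint_isBigO τ hF.analyticAt_fst_sub hF.fst_eq_zero

theorem snd_graphPoint_sub_isBigO (hF : IsTangentToIdentity P Q F₁ F₂ j) (τ : ℝ) :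
    (fun z => F₂ (graphPoint P Q τ z) - z) =O[𝓝 0] fun z => P z ^ j :=
  hF.comp_graphPoint_isBigO τ hF.analyticAt_snd_sub hF.snd_eq_zero

section Gauge

variable {l : Filter ℂ} {G : ℂ → ℝ}

theorem fst_graphPoint_sub_leading_isLittleO (hF : IsTangentToIdentity P Q F₁ F₂ j)
    (hG : IsGauge P (fstLeadingCoeff F₁ j) (sndLeadingCoeff F₂ j) l G) (τ : ℝ) :
    (fun z => F₁ (graphPoint P Q τ z) - (graphPoint P Q τ z).1 -
      (P z * (-1 + τ * Complex.I)) ^ (j + 1) * fstLeadingCoeff F₁ j z) =o[l]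
      fun z => P z ^ (j + 1) * G z :=
  hF.comp_graphPoint_sub_isLittleO τ hF.analyticAt_fst_sub hF.fst_eq_zero hG.le_nhds
    (hG.self_isLittleO hF.toIsRadialFlat) hG.fst_isBigO

theorem fst_graphPoint_sub_isBigO_gauge (hF : IsTangentToIdentity P Q F₁ F₂ j)
    (hG : IsGauge P (fstLeadingCoeff F₁ j) (sndLeadingCoeff F₂ j) l G) (τ : ℝ) :
    (fun z => F₁ (graphPoint P Q τ z) - (graphPoint P Q τ z).1) =O[l]
      fun z => P z ^ (j + 1) * G z := by
  have hmain := ((isBigO_ofReal_self P l).pow (j + 1)).mul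
    (hG.fst_isBigO.const_mul_left ((-1 + τ * Complex.I) ^ (j + 1)))
  refine ((hF.fst_graphPoint_sub_leading_isLittleO hG τ).isBigO.add hmain).congr_left fun z => ?_
  rw [mul_pow, mul_assoc, sub_add_cancel]

theorem snd_graphPoint_sub_isLittleO (hF : IsTangentToIdentity P Q F₁ F₂ j)
    (hG : IsGauge P (fstLeadingCoeff F₁ j) (sndLeadingCoeff F₂ j) l G) (τ : ℝ) :
    (fun z => F₂ (graphPoint P Q τ z) - z) =o[l] fun z => P z ^ j * G z := by
  have hrem := hF.comp_graphPoint_sub_isLittleO τ hF.analyticAt_snd_sub hF.snd_eq_zero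
    hG.le_nhds (hG.self_isLittleO hF.toIsRadialFlat) hG.snd_isLittleO.isBigO
  have hmain := ((isBigO_ofReal_self P l).pow j).mul_isLittleO
    (hG.snd_isLittleO.const_mul_left ((-1 + τ * Complex.I) ^ j))
  refine (hrem.add hmain).congr_left fun z => ?_
  rw [sndLeadingCoeff, mul_pow, mul_assoc, sub_add_cancel, graphPoint]

theorem im_fst_sub_mul_coupling_isLittleO (hF : IsTangentToIdentity P Q F₁ F₂ j)
    (hG : IsGauge P (fstLeadingCoeff F₁ j) (sndLeadingCoeff F₂ j) l G) (τ : ℝ) :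
    (fun z => (F₁ (graphPoint P Q τ z) - (graphPoint P Q τ z).1).im *
      Q (F₂ (graphPoint P Q τ z)) (F₁ (graphPoint P Q τ z)).im) =o[l]
      fun z => P z ^ (j + 1) * G z := by
  simpa only [mul_one] using
    ((isBigO_im_self _ _).trans (hF.fst_graphPoint_sub_isBigO_gauge hG τ)).mul_isLittleO
      ((isLittleO_one_iff ℝ).2 ((hF.tendsto_coupling_graphPoint τ).mono_left hG.le_nhds))

theorem mul_coupling_graphPoint_sub_isLittleO (hF : IsTangentToIdentity P Q F₁ F₂ j)
    (hG : IsGauge P (fstLeadingCoeff F₁ j) (sndLeadingCoeff F₂ j) l G) (τ : ℝ) :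
    (fun z => τ * P z * (Q (F₂ (graphPoint P Q τ z)) (F₁ (graphPoint P Q τ z)).im -
      Q z (τ * P z))) =o[l] fun z => P z ^ (j + 1) * G z := by
  have hfst : (fun z => (F₁ (graphPoint P Q τ z)).im - τ * P z) =o[l] fun z => P z ^ j * G z := by
    have hbound := ((isBigO_im_self _ _).trans (hF.fst_graphPoint_sub_isBigO τ)).mono hG.le_nhds
    simp only [Complex.sub_im, graphPoint_fst_im, pow_succ] at hbound
    exact hbound.trans_isLittleO
      ((isBigO_refl _ _).mul_isLittleO (hG.self_isLittleO hF.toIsRadialFlat))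
  have hdiff := ((hF.coupling_sub_isBigO (hF.tendsto_snd_graphPoint τ) tendsto_id
    (hF.tendsto_im_fst_graphPoint τ) (hF.tendsto_mul τ)).mono hG.le_nhds).trans_isLittleO
      ((hF.snd_graphPoint_sub_isLittleO hG τ).norm_left.add hfst.norm_left)
  exact (((isBigO_refl P l).const_mul_left τ).mul_isLittleO hdiff).congr_right fun z => by ring

theorem quadratic_remainder_isLittleO (hF : IsTangentToIdentity P Q F₁ F₂ j) (hj : j ≠ 0)
    (hG : IsGauge P (fstLeadingCoeff F₁ j) (sndLeadingCoeff F₂ j) l G) (τ : ℝ) :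
    (fun z => P (F₂ (graphPoint P Q τ z)) - P z - fderiv ℝ P z (F₂ (graphPoint P Q τ z) - z))
      =o[l] fun z => P z ^ (j + 1) * G z := by
  obtain ⟨N, hN⟩ := hG.exists_pow_isLittleO
  obtain ⟨k, rfl⟩ := Nat.exists_eq_add_one_of_ne_zero hj
  have htaylor := hF.flat.sub_sub_fderiv_isBigO hF.smooth (hF.snd_graphPoint_isBigO τ)
    (b := fun z => z) (isBigO_refl (fun z : ℂ => z) _).norm_right tendsto_norm_zero N
  have hsq : (fun z => ‖F₂ (graphPoint P Q τ z) - z‖ ^ 2) =O[𝓝 0] fun z => P z ^ (k + 1 + 1) := by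
    refine ((hF.snd_graphPoint_sub_isBigO τ).norm_left.pow 2).trans ?_
    have hpow := (isBigO_refl (fun z => P z ^ (k + 1 + 1)) (𝓝 0)).mul
      ((hF.tendsto_zero.pow k).isBigO_one ℝ)
    exact hpow.congr (fun z => by ring) fun z => mul_one _
  exact ((htaylor.trans ((isBigO_refl _ _).mul hsq)).mono hG.le_nhds).trans_isLittleO
    ((hN.mul_isBigO (isBigO_refl _ _)).congr_right fun z => mul_comm _ _)

theorem fderiv_snd_sub_leading_isLittleO (hF : IsTangentToIdentity P Q F₁ F₂ j)
    (hG : IsGauge P (fstLeadingCoeff F₁ j) (sndLeadingCoeff F₂ j) l G) (τ : ℝ) :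
    (fun z => fderiv ℝ P z (F₂ (graphPoint P Q τ z) - z -
      (P z * (-1 + τ * Complex.I)) ^ j * sndLeadingCoeff F₂ j z)) =o[l]
      fun z => P z ^ (j + 1) * G z := by
  have happly : ∀ v : ℂ → ℂ, (fun z => fderiv ℝ P z (v z)) =O[l]
      fun z => ‖fderiv ℝ P z‖ * ‖v z‖ := fun v =>
    isBigO_of_le _ fun z => by simpa using (fderiv ℝ P z).le_opNorm (v z)
  have hrem : (fun z => fderiv ℝ P z (F₂ (graphPoint P Q τ z) - z -
      (P z * graphSlope P Q τ z) ^ j * sndLeadingCoeff F₂ j z)) =o[l]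
      fun z => P z ^ (j + 1) * G z := by
    have hbound := (hF.comp_graphPoint_sub_isBigO τ hF.analyticAt_snd_sub hF.snd_eq_zero).mono
      hG.le_nhds
    exact (happly _).trans_isLittleO (((hG.fderiv_isLittleO hF.toIsRadialFlat).norm_left.mul_isBigO
      hbound.norm_left).congr_right fun z => mul_comm _ _)
  have hslope : (fun z => fderiv ℝ P z (P z ^ j * (graphSlope P Q τ z ^ j -
      (-1 + τ * Complex.I) ^ j) * sndLeadingCoeff F₂ j z)) =o[l]
      fun z => P z ^ (j + 1) * G z := by
    have hbound := (((isBigO_refl P l).pow j).norm_left.mul_isLittleO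
      ((hF.graphSlope_pow_sub_isLittleO τ j).mono hG.le_nhds).norm_left).mul_isBigO
        hG.fderiv_mul_snd_isBigO
    refine (happly _).trans_isLittleO (hbound.congr (fun z => ?_) fun z => by ring)
    simp only [norm_mul, norm_pow, Complex.norm_real]
    ring
  refine (hrem.add hslope).congr_left fun z => ?_
  rw [← map_add]
  congr 1
  simp only [mul_pow]
  ring

theorem leading_eq (hF : IsTangentToIdentity P Q F₁ F₂ j) (hj : j ≠ 0)
    (hG : IsGauge P (fstLeadingCoeff F₁ j) (sndLeadingCoeff F₂ j) l G) (τ : ℝ) :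
    (fun z => ((-1 + τ * Complex.I) ^ (j + 1) * fstLeadingCoeff F₁ j z).re +
      (P z)⁻¹ * fderiv ℝ P z ((-1 + τ * Complex.I) ^ j * sndLeadingCoeff F₂ j z)) =o[l] G := by
  have hpos := hG.le hF.eventually_pos
  have hsum := (((((isBigO_re_self _ _).trans_isLittleO
    (hF.fst_graphPoint_sub_leading_isLittleO hG τ)).add
    (hF.quadratic_remainder_isLittleO hj hG τ)).add
    (hF.im_fst_sub_mul_coupling_isLittleO hG τ)).add
    (hF.mul_coupling_graphPoint_sub_isLittleO hG τ)).add
    (hF.fderiv_snd_sub_leading_isLittleO hG τ)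
  refine ((isBigO_refl (fun z => (P z ^ (j + 1))⁻¹) l).mul_isLittleO hsum.neg_left).congr' ?_ ?_
  · filter_upwards [hpos, hG.le_nhds (hF.graphFunction_map_graphPoint_sub τ)] with z hz hinv
    have hfst : ((P z * (-1 + τ * Complex.I)) ^ (j + 1) * fstLeadingCoeff F₁ j z).re =
        P z ^ (j + 1) * ((-1 + τ * Complex.I) ^ (j + 1) * fstLeadingCoeff F₁ j z).re := by
      rw [← Complex.re_ofReal_mul, Complex.ofReal_pow, mul_pow, mul_assoc]
    have hsnd : fderiv ℝ P z ((P z * (-1 + τ * Complex.I)) ^ j * sndLeadingCoeff F₂ j z) =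
        P z ^ j * fderiv ℝ P z ((-1 + τ * Complex.I) ^ j * sndLeadingCoeff F₂ j z) := by
      rw [← smul_eq_mul (P z ^ j), ← map_smul, Complex.real_smul, Complex.ofReal_pow, mul_pow,
        mul_assoc]
    rw [inv_mul_eq_iff_eq_mul₀ (pow_ne_zero _ hz.ne'), Complex.sub_re, hfst,
      map_sub _ (F₂ (graphPoint P Q τ z) - z), hsnd]
    linear_combination -hinv - P z ^ j *
      fderiv ℝ P z ((-1 + τ * Complex.I) ^ j * sndLeadingCoeff F₂ j z) * mul_inv_cancel₀ hz.ne'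
  · filter_upwards [hpos] with z hz
    exact inv_mul_cancel_left₀ (pow_ne_zero _ hz.ne') _

end Gauge

end IsTangentToIdentity

/-! ### Leading coefficients along rays -/

theorem isEquivalent_of_sub_isLittleO_add {ι E : Type*} [NormedAddCommGroup E] {l : Filter ι}
    {f g : ι → E} (h : (f - g) =o[l] fun x => ‖f x‖ + ‖g x‖) : f ~[l] g := by
  refine h.trans_isBigO (IsBigO.of_bound 4 ?_)
  filter_upwards [h.def (half_pos one_pos)] with x hx
  have hsub := norm_sub_norm_le (f x) (g x)
  rw [Pi.sub_apply, Real.norm_of_nonneg (by positivity)] at hx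
  rw [Real.norm_of_nonneg (by positivity)]
  linarith

section Rays

variable {α β : ℂ → ℂ} {L : ℝ → ℝ} {l : Filter ℝ}

theorem eventually_eq_zero_of_ray [l.NeBot] (hl : l ≤ 𝓝[>] 0) (hα : AnalyticAt ℂ α 0)
    (h : ∀ᶠ r : ℝ in l, α r = 0) : ∀ᶠ z in 𝓝 0, α z = 0 := by
  refine hα.eventually_eq_zero_or_eventually_ne_zero.resolve_right fun hne => ?_
  obtain ⟨r, hr, hr0⟩ := (h.and (hl (tendsto_ofReal_punctured.eventually hne))).exists
  exact hr0 hr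

theorem eventually_eq_zero_iff_of_isEquivalent_ray [l.NeBot] (hl : l ≤ 𝓝[>] 0)
    (hL : ∀ᶠ r in l, L r ≠ 0) (hα : AnalyticAt ℂ α 0) (hβ : AnalyticAt ℂ β 0)
    (h : (fun r : ℝ => L r * β r) ~[l] fun r => 2 * α r) :
    (∀ᶠ z in 𝓝 0, α z = 0) ↔ ∀ᶠ z in 𝓝 0, β z = 0 := by
  have hray : ∀ {g : ℂ → ℂ}, (∀ᶠ z in 𝓝 0, g z = 0) → ∀ᶠ r : ℝ in l, g r = 0 := fun hg =>
    hl (tendsto_ofReal_zero.eventually hg)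
  constructor <;> intro hzero
  · have hright : (fun r : ℝ => 2 * α r) =ᶠ[l] 0 := by
      filter_upwards [hray hzero] with r hr
      rw [hr, mul_zero, Pi.zero_apply]
    refine eventually_eq_zero_of_ray hl hβ ?_
    filter_upwards [isEquivalent_zero_iff_eventually_zero.1 (h.congr_right hright), hL]
      with r hr hLr
    exact (mul_eq_zero.1 hr).resolve_left (Complex.ofReal_ne_zero.2 hLr)
  · have hleft : (fun r : ℝ => L r * β r) =ᶠ[l] 0 := by
      filter_upwards [hray hzero] with r hr
      rw [hr, mul_zero, Pi.zero_apply]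
    refine eventually_eq_zero_of_ray hl hα ?_
    filter_upwards [isEquivalent_zero_iff_eventually_zero.1 (h.symm.congr_right hleft)] with r hr
    exact (mul_eq_zero.1 hr).resolve_left two_ne_zero

theorem tendsto_mul_pow_div_pow_of_isEquivalent_ray (hl : l ≤ 𝓝[>] 0) {p q : ℂ → ℂ} {m k : ℕ}
    (hp : ContinuousAt p 0) (hα : ∀ᶠ z in 𝓝 0, α z = z ^ m * p z)
    (hq : ContinuousAt q 0) (hq0 : q 0 ≠ 0) (hβ : ∀ᶠ z in 𝓝 0, β z = z ^ k * q z)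
    {u : ℂ} (hu : u ≠ 0)
    (h : (fun r : ℝ => L r * (star u * β (r * u))) ~[l] fun r => 2 * α (r * u)) :
    Tendsto (fun r : ℝ => (L r : ℂ) * r ^ k / r ^ m) l
      (𝓝 (2 * (u ^ m * p 0) / (star u * (u ^ k * q 0)))) := by
  have hnum : Tendsto (fun r : ℝ => L r * (star u * β (r * u)) / (r : ℂ) ^ m) l
      (𝓝 (2 * (u ^ m * p 0))) := by
    have hlim := ((tendsto_ray_div_pow hp hα u).mono_left hl).const_mul 2
    simp only [← mul_div_assoc] at hlim
    exact (h.symm.div (IsEquivalent.refl (u := fun r : ℝ => (r : ℂ) ^ m))).tendsto_nhds hlim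
  have hden : Tendsto (fun r : ℝ => star u * (β (r * u) / (r : ℂ) ^ k)) l
      (𝓝 (star u * (u ^ k * q 0))) :=
    ((tendsto_ray_div_pow hq hβ u).mono_left hl).const_mul _
  have hlim0 : star u * (u ^ k * q 0) ≠ 0 :=
    mul_ne_zero (star_ne_zero.2 hu) (mul_ne_zero (pow_ne_zero k hu) hq0)
  refine (hnum.div hden hlim0).congr' ?_
  filter_upwards [hden.eventually_ne hlim0, hl self_mem_nhdsWithin] with r hr hr0
  have hrk : (r : ℂ) ^ k ≠ 0 := pow_ne_zero k (Complex.ofReal_ne_zero.2 (ne_of_gt hr0))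
  rw [← mul_div_assoc] at hr
  obtain ⟨hβr, -⟩ := div_ne_zero_iff.1 hr
  simp only [Pi.div_apply]
  rw [← mul_div_assoc, div_div_eq_mul_div, div_mul_eq_mul_div, div_right_comm, mul_right_comm,
    mul_div_cancel_right₀ _ hβr]

/- The orders `m` of `α` and `k` of `β` would satisfy `k = m + 1`, since `star u * uᵏ` must be a
multiple of `uᵐ`; then `r L r` would converge. -/
theorem eventually_eq_zero_of_isEquivalent_ray [l.NeBot] (hl : l ≤ 𝓝[>] 0)
    (hL : Tendsto (fun r => r * L r) l atTop) (hα : AnalyticAt ℂ α 0) (hβ : AnalyticAt ℂ β 0)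
    (h : ∀ u : ℂ, ‖u‖ = 1 →
      (fun r : ℝ => L r * (star u * β (r * u))) ~[l] fun r => 2 * α (r * u)) :
    (∀ᶠ z in 𝓝 0, α z = 0) ∧ ∀ᶠ z in 𝓝 0, β z = 0 := by
  have hL0 : ∀ᶠ r in l, L r ≠ 0 := by
    filter_upwards [hL.eventually_gt_atTop 0] with r hr
    exact right_ne_zero_of_mul hr.ne'
  have hiff := eventually_eq_zero_iff_of_isEquivalent_ray hl hL0 hα hβ
    (by simpa only [star_one, one_mul, mul_one] using h 1 norm_one)
  suffices hα0 : ∀ᶠ z in 𝓝 0, α z = 0 from ⟨hα0, hiff.1 hα0⟩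
  by_contra hne
  obtain ⟨m, p, hp, hp0, hαp⟩ := exists_eventually_eq_pow_mul hα hne
  obtain ⟨k, q, hq, hq0, hβq⟩ := exists_eventually_eq_pow_mul hβ (mt hiff.2 hne)
  have hlim : ∀ u : ℂ, ‖u‖ = 1 → _ := fun u hu =>
    tendsto_mul_pow_div_pow_of_isEquivalent_ray hl hp.continuousAt hαp hq.continuousAt hq0 hβq
      (ne_zero_of_norm_eq_one hu) (h u hu)
  have hk : k = m + 1 := eq_of_forall_unit_pow_eq fun u hu => by
    have heq := tendsto_nhds_unique (hlim u hu) (hlim 1 norm_one)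
    have hu0 := ne_zero_of_norm_eq_one hu
    have hstar : star u * u = 1 := by
      rw [Complex.star_def, Complex.conj_mul', hu, Complex.ofReal_one, one_pow]
    have hstar0 := left_ne_zero_of_mul_eq_one hstar
    rw [star_one, one_pow, one_pow, div_eq_div_iff (by simp [hu0, hq0]) (by simp [hq0])] at heq
    have hcancel : u ^ m = star u * u ^ k := by
      refine mul_left_cancel₀ (mul_ne_zero (mul_ne_zero two_ne_zero hp0) hq0) ?_
      linear_combination heq
    rw [pow_succ, hcancel]
    linear_combination -u ^ k * hstar
  subst hk
  refine not_tendsto_nhds_of_tendsto_atTop hL _ ((hlim 1 norm_one).norm.congr' ?_)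
  filter_upwards [hL.eventually_gt_atTop 0, hl self_mem_nhdsWithin] with r hLr hr
  rw [pow_succ, mul_div_assoc, mul_div_cancel_left₀ _
    (pow_ne_zero m (Complex.ofReal_ne_zero.2 (ne_of_gt hr))), ← Complex.ofReal_mul,
    Complex.norm_real, mul_comm, Real.norm_of_nonneg hLr.le]

end Rays

namespace IsRadialFlat

variable {P : ℂ → ℝ}

theorem inv_mul_fderiv_ray (hP : IsRadialFlat P) {u : ℂ} (hu : ‖u‖ = 1) :
    ∀ᶠ r : ℝ in 𝓝[>] 0, ∀ w : ℂ,
      (P (r * u))⁻¹ * fderiv ℝ P (r * u) w = radialLogDeriv P r * (star u * w).re := by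
  filter_upwards [hP.fderiv_ray, tendsto_ofReal_zero.eventually hP.map_unit_mul] with r hderiv hr w
  rw [hderiv u hu, mul_comm (r : ℂ) u, hr u hu, radialLogDeriv, smul_apply,
    innerSL_apply_apply, Complex.inner, Complex.star_def, smul_eq_mul, mul_comm w]
  ring

theorem norm_fderiv_div_ray (hP : IsRadialFlat P) {u : ℂ} (hu : ‖u‖ = 1) :
    ∀ᶠ r : ℝ in 𝓝[>] 0, ‖fderiv ℝ P (r * u)‖ / P (r * u) = ‖radialLogDeriv P r‖ := by
  filter_upwards [hP.fderiv_ray, tendsto_ofReal_zero.eventually hP.map_unit_mul,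
    tendsto_ofReal_punctured.eventually hP.eventually_pos] with r hderiv hr hpos
  rw [hderiv u hu, mul_comm (r : ℂ) u, hr u hu, radialLogDeriv, norm_smul, innerSL_apply_norm, hu,
    mul_one, norm_div, Real.norm_of_nonneg hpos.le]

theorem tendsto_norm_fderiv_div_ray (hP : IsRadialFlat P) {l : Filter ℝ} (hl : l ≤ 𝓝[>] 0)
    (hL : Tendsto (fun r => r * radialLogDeriv P r) l atTop) {u : ℂ} (hu : ‖u‖ = 1) :
    Tendsto (fun r : ℝ => ‖fderiv ℝ P (r * u)‖ / P (r * u)) l atTop := by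
  refine tendsto_atTop_mono' l ?_ hL
  filter_upwards [hl (hP.norm_fderiv_div_ray hu), hl (Ioo_mem_nhdsGT one_pos)] with r hr hr1
  rw [hr]
  calc r * radialLogDeriv P r ≤ ‖r * radialLogDeriv P r‖ := Real.le_norm_self _
    _ = r * ‖radialLogDeriv P r‖ := by rw [norm_mul, Real.norm_of_nonneg hr1.1.le]
    _ ≤ ‖radialLogDeriv P r‖ := mul_le_of_le_one_left (norm_nonneg _) hr1.2.le

end IsRadialFlat

namespace IsTangentToIdentity

variable {P : ℂ → ℝ} {Q : ℂ → ℝ → ℝ} {F₁ F₂ : ℂ × ℂ → ℂ} {j : ℕ}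

theorem leading_isEquivalent_ray (hF : IsTangentToIdentity P Q F₁ F₂ j) (hj : j ≠ 0)
    (hne : ¬ ((∀ᶠ z in 𝓝 0, fstLeadingCoeff F₁ j z = 0) ∧
      ∀ᶠ z in 𝓝 0, sndLeadingCoeff F₂ j z = 0))
    {l : Filter ℝ} (hl : l ≤ 𝓝[>] 0)
    (hL : Tendsto (fun r => r * radialLogDeriv P r) l atTop) {u : ℂ} (hu : ‖u‖ = 1) :
    (fun r : ℝ => radialLogDeriv P r * (star u * sndLeadingCoeff F₂ j (r * u))) ~[l]
      fun r => 2 * fstLeadingCoeff F₁ j (r * u) := by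
  have hgauge := hF.isGauge (hF.analyticAt_fstLeadingCoeff j) (hF.analyticAt_sndLeadingCoeff j) hne
    ((tendsto_ofReal_mul_punctured (ne_zero_of_norm_eq_one hu)).mono_left hl)
    (hF.tendsto_norm_fderiv_div_ray hl hL hu)
  refine isEquivalent_of_sub_isLittleO_add ((sub_two_mul_isLittleO hj fun τ =>
    (isLittleO_map.1 (hF.leading_eq hj hgauge τ)).congr' ?_ EventuallyEq.rfl).trans_isBigO
      (IsBigO.of_norm_eventuallyLE ?_))
  · filter_upwards [hl (hF.inv_mul_fderiv_ray hu)] with r hr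
    simp only [Function.comp_apply]
    rw [hr, ← Complex.re_ofReal_mul, ← Complex.add_re]
    ring_nf
  · filter_upwards [hl (hF.norm_fderiv_div_ray hu)] with r hr
    simp only [Function.comp_apply]
    rw [hr, Real.norm_of_nonneg (by positivity), norm_mul, norm_mul (star u), norm_star, hu,
      one_mul, Complex.norm_real, norm_mul 2, Complex.norm_two]
    linarith [norm_nonneg (fstLeadingCoeff F₁ j (r * u))]

theorem leadingCoeff_eventually_eq_zero (hF : IsTangentToIdentity P Q F₁ F₂ j) (hj : j ≠ 0) :
    (∀ᶠ z in 𝓝 0, fstLeadingCoeff F₁ j z = 0) ∧ ∀ᶠ z in 𝓝 0, sndLeadingCoeff F₂ j z = 0 := by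
  obtain ⟨l, hl, hlne, hL⟩ :=
    exists_neBot_le_tendsto_atTop hF.frequently_natCast_le_mul_radialLogDeriv
  by_contra hne
  exact hne (eventually_eq_zero_of_isEquivalent_ray hl hL
    (hF.analyticAt_fstLeadingCoeff j) (hF.analyticAt_sndLeadingCoeff j)
    fun u hu => hF.leading_isEquivalent_ray hj hne hl hL hu)

theorem succ (hF : IsTangentToIdentity P Q F₁ F₂ j) (hj : j ≠ 0) :
    IsTangentToIdentity P Q F₁ F₂ (j + 1) where
  toIsModelSelfMap := hF.toIsModelSelfMap
  fst_eq_zero m hm := (Nat.lt_succ_iff_lt_or_eq.1 hm).elim (hF.fst_eq_zero m) fun h =>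
    h ▸ (hF.leadingCoeff_eventually_eq_zero hj).1
  snd_eq_zero m hm := (Nat.lt_succ_iff_lt_or_eq.1 hm).elim (hF.snd_eq_zero m) fun h =>
    h ▸ (hF.leadingCoeff_eventually_eq_zero hj).2

end IsTangentToIdentity

namespace IsModelSelfMap

variable {P : ℂ → ℝ} {Q : ℂ → ℝ → ℝ} {F₁ F₂ : ℂ × ℂ → ℂ}

theorem isTangentToIdentity_one (hF : IsModelSelfMap P Q F₁ F₂)
    (hderiv : deriv (fun w : ℂ => F₂ (0, w)) 0 = 1) : IsTangentToIdentity P Q F₁ F₂ 1 where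
  toIsModelSelfMap := hF
  fst_eq_zero m hm := by
    obtain rfl | rfl : m = 0 ∨ m = 1 := by omega
    · simpa only [fstCoeff_zero, sub_zero] using hF.eventually_fst_zero
    · have haxis : Tendsto (fun w : ℂ => ((0 : ℂ), w)) (𝓝 0) (𝓝 0) :=
        (Continuous.prodMk_right 0).tendsto 0
      filter_upwards [hF.eventually_fstCoeff_one_eq hderiv,
        haxis.eventually hF.analytic₁.eventually_analyticAt] with w hw hanalytic
      rw [fstCoeff_one, partialFst] at hw ⊢
      rw [fderiv_fun_sub hanalytic.differentiableAt differentiableAt_fst, fderiv_fst,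
        sub_apply, hw, ContinuousLinearMap.coe_fst', sub_self]
  snd_eq_zero m hm := by
    obtain rfl : m = 0 := by omega
    filter_upwards [hF.eventually_snd_eq hderiv] with w hw
    rw [fstCoeff_zero, hw, sub_self]

theorem isTangentToIdentity (hF : IsModelSelfMap P Q F₁ F₂)
    (hderiv : deriv (fun w : ℂ => F₂ (0, w)) 0 = 1) (j : ℕ) :
    IsTangentToIdentity P Q F₁ F₂ (j + 1) := by
  induction j with
  | zero => exact hF.isTangentToIdentity_one hderiv
  | succ j ih => exact ih.succ j.succ_ne_zero

theorem eventually_eq_id (hF : IsModelSelfMap P Q F₁ F₂)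
    (hderiv : deriv (fun w : ℂ => F₂ (0, w)) 0 = 1) :
    ∀ᶠ z in 𝓝 (0 : ℂ × ℂ), F₁ z = z.1 ∧ F₂ z = z.2 := by
  have hfst := eventually_eq_zero_of_fstCoeff hF.analyticAt_fst_sub fun n =>
    (hF.isTangentToIdentity hderiv n).fst_eq_zero n (by omega)
  have hsnd := eventually_eq_zero_of_fstCoeff hF.analyticAt_snd_sub fun n =>
    (hF.isTangentToIdentity hderiv n).snd_eq_zero n n.lt_succ_self
  filter_upwards [hfst, hsnd] with z hz₁ hz₂ using ⟨sub_eq_zero.1 hz₁, sub_eq_zero.1 hz₂⟩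

theorem unit_mul_snd (hF : IsModelSelfMap P Q F₁ F₂) {u : ℂ} (hu : ‖u‖ = 1) :
    IsModelSelfMap P Q F₁ fun z => u * F₂ z where
  toIsModelGerm := hF.toIsModelGerm
  analytic₁ := hF.analytic₁
  analytic₂ := analyticAt_const.mul hF.analytic₂
  map_zero₁ := hF.map_zero₁
  map_zero₂ := by rw [hF.map_zero₂, mul_zero]
  maps := by
    have hcont := hF.analytic₁.continuousAt.prodMk hF.analytic₂.continuousAt
    rw [ContinuousAt, hF.map_zero₁, hF.map_zero₂] at hcont
    filter_upwards [hF.maps, hcont.eventually hF.graphFunction_unit_mul] with z hz hrot hmem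
    rw [hrot u hu, hz hmem]

theorem exists_eventually_eq_rotationMap (hF : IsModelSelfMap P Q F₁ F₂)
    (hne : fstCoeff F₁ 1 0 ≠ 0) : ∃ t : ℝ, ∀ᶠ z in 𝓝 0, (F₁ z, F₂ z) = rotationMap t z := by
  set b := deriv (fun w : ℂ => F₂ (0, w)) 0 with hb
  have hb_norm : ‖b‖ = 1 := hF.norm_deriv_snd_eq_one hne
  have hb_ne := ne_zero_of_norm_eq_one hb_norm
  have hrot := hF.unit_mul_snd (u := b⁻¹) (by rw [norm_inv, hb_norm, inv_one])
  have hderiv : deriv (fun w : ℂ => b⁻¹ * F₂ (0, w)) 0 = 1 := by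
    rw [deriv_const_mul _ (analyticAt_zero_left hF.analytic₂).differentiableAt, ← hb,
      inv_mul_cancel₀ hb_ne]
  obtain ⟨t, ht⟩ := (Complex.norm_eq_one_iff b).1 hb_norm
  refine ⟨t, ?_⟩
  filter_upwards [hrot.eventually_eq_id hderiv] with z hz
  rw [rotationMap, hz.1, ← hz.2, mul_comm Complex.I, ht, mul_inv_cancel_left₀ hb_ne]

theorem fderiv_fst_apply_snd (hF : IsModelSelfMap P Q F₁ F₂) : fderiv ℂ F₁ 0 (0, 1) = 0 := by
  have haxis : HasDerivAt (fun w : ℂ => ((0 : ℂ), w)) (0, 1) 0 :=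
    (hasDerivAt_const _ _).prodMk (hasDerivAt_id _)
  refine (hF.analytic₁.differentiableAt.hasFDerivAt.comp_hasDerivAt (0 : ℂ) haxis).unique
    ((hasDerivAt_const (0 : ℂ) (0 : ℂ)).congr_of_eventuallyEq hF.eventually_fst_zero)

theorem fstCoeff_one_ne_zero (hF : IsModelSelfMap P Q F₁ F₂) {g : ℂ × ℂ → ℂ × ℂ}
    (hg : AnalyticAt ℂ g 0) (hg0 : g 0 = 0) (hinv : ∀ᶠ w in 𝓝 0, F₁ (g w) = w.1) :
    fstCoeff F₁ 1 0 ≠ 0 := by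
  rw [fstCoeff_one, partialFst]
  intro hzero
  have hfderiv : fderiv ℂ F₁ 0 = 0 := by
    ext
    exacts [hzero, hF.fderiv_fst_apply_snd]
  have hF₁ : HasFDerivAt F₁ (0 : ℂ × ℂ →L[ℂ] ℂ) (g 0) := by
    rw [hg0, ← hfderiv]
    exact hF.analytic₁.differentiableAt.hasFDerivAt
  have hcomp := (hF₁.comp (0 : ℂ × ℂ) hg.differentiableAt.hasFDerivAt).unique
    (hasFDerivAt_fst.congr_of_eventuallyEq hinv)
  simpa using DFunLike.congr_fun hcomp (1, 0)

end IsModelSelfMap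

/-! ### The stability group -/

section RotationMap

variable (t : ℝ)

theorem rotationMap_neg_comp (z : ℂ × ℂ) : rotationMap (-t) (rotationMap t z) = z := by
  rw [rotationMap, rotationMap, ← mul_assoc, ← Complex.exp_add, Complex.ofReal_neg, mul_neg,
    neg_add_cancel, Complex.exp_zero, one_mul]

theorem rotationMap_zero : rotationMap t 0 = 0 :=
  Prod.ext rfl (mul_zero _)

theorem analyticAt_rotationMap (z : ℂ × ℂ) : AnalyticAt ℂ (rotationMap t) z :=
  analyticAt_fst.prod (analyticAt_const.mul analyticAt_snd)

theorem isLocalBiholomorphismAt_rotationMap (z : ℂ × ℂ) :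
    IsLocalBiholomorphismAt (rotationMap t) z :=
  ⟨analyticAt_rotationMap t z, rotationMap (-t), analyticAt_rotationMap (-t) _,
    .of_forall (rotationMap_neg_comp t),
    .of_forall fun w => by simpa only [neg_neg] using rotationMap_neg_comp (-t) w⟩

end RotationMap

section StabilityGroup

variable {ε₀ δ₀ : ℝ} {P : ℂ → ℝ} {Q : ℂ → ℝ → ℝ}

theorem eventually_mem_graphHypersurface_iff (hε₀ : 0 < ε₀) (hδ₀ : 0 < δ₀) (P : ℂ → ℝ)
    (Q : ℂ → ℝ → ℝ) :
    ∀ᶠ z in 𝓝 (0 : ℂ × ℂ), z ∈ graphHypersurface ε₀ δ₀ P Q ↔ graphFunction P Q z = 0 := by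
  have hsnd : Tendsto (fun z : ℂ × ℂ => ‖z.2‖) (𝓝 0) (𝓝 0) :=
    Continuous.tendsto' (by fun_prop) _ _ norm_zero
  have him : Tendsto (fun z : ℂ × ℂ => |z.1.im|) (𝓝 0) (𝓝 0) :=
    Continuous.tendsto' (by fun_prop) _ _ abs_zero
  filter_upwards [hsnd.eventually_lt_const hε₀, him.eventually_lt_const hδ₀] with z hz₂ hz₁
  exact ⟨fun h => h.2.2, fun h => ⟨hz₂, hz₁, h⟩⟩

theorem IsModelGerm.rotationMap_mem_stabilityGroup (h : IsModelGerm P Q) (hε₀ : 0 < ε₀)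
    (hδ₀ : 0 < δ₀) (t : ℝ) :
    (rotationMap t : (𝓝 (0 : ℂ × ℂ)).Germ (ℂ × ℂ)) ∈
      stabilityGroup (graphHypersurface ε₀ δ₀ P Q) 0 := by
  have hmem := eventually_mem_graphHypersurface_iff hε₀ hδ₀ P Q
  have hlim : Tendsto (rotationMap t) (𝓝 0) (𝓝 0) := by
    simpa only [rotationMap_zero] using (analyticAt_rotationMap t 0).continuousAt.tendsto
  refine ⟨rotationMap t, rfl, isLocalBiholomorphismAt_rotationMap t 0, rotationMap_zero t, ?_⟩
  filter_upwards [hmem, hlim.eventually hmem, h.graphFunction_unit_mul] with z hz hrot hinv hzM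
  exact hrot.2 ((hinv _ (Complex.norm_exp_I_mul_ofReal t)).trans (hz.1 hzM))

theorem IsModelGerm.exists_eventually_eq_rotationMap (h : IsModelGerm P Q) (hε₀ : 0 < ε₀)
    (hδ₀ : 0 < δ₀) {f : ℂ × ℂ → ℂ × ℂ} (hf : IsLocalBiholomorphismAt f 0) (hf0 : f 0 = 0)
    (hmaps : ∀ᶠ z in 𝓝 0, z ∈ graphHypersurface ε₀ δ₀ P Q → f z ∈ graphHypersurface ε₀ δ₀ P Q) :
    ∃ t : ℝ, f =ᶠ[𝓝 0] rotationMap t := by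
  obtain ⟨hanalytic, g, hg, hgf, hfg⟩ := hf
  have hmem := eventually_mem_graphHypersurface_iff hε₀ hδ₀ P Q
  have hlim := hanalytic.continuousAt.tendsto
  rw [hf0] at hg hfg hlim
  have hg0 : g 0 = 0 := by simpa only [hf0] using hgf.self_of_nhds
  have hF : IsModelSelfMap P Q (fun z => (f z).1) fun z => (f z).2 :=
    { toIsModelGerm := h
      analytic₁ := analyticAt_fst.comp hanalytic
      analytic₂ := analyticAt_snd.comp hanalytic
      map_zero₁ := congrArg Prod.fst hf0
      map_zero₂ := congrArg Prod.snd hf0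
      maps := by
        filter_upwards [hmem, hlim.eventually hmem, hmaps] with z hz hfz hzM hzero
        exact hfz.1 (hzM (hz.2 hzero)) }
  exact hF.exists_eventually_eq_rotationMap
    (hF.fstCoeff_one_ne_zero hg hg0 (hfg.mono fun w hw => congrArg Prod.fst hw))

theorem isModelGerm_of_contDiffOn (hε₀ : 0 < ε₀) (hδ₀ : 0 < δ₀)
    (hP : ContDiffOn ℝ ∞ P (Metric.ball 0 ε₀))
    (hQ : ContDiffOn ℝ ∞ (fun x : ℂ × ℝ => Q x.1 x.2) (Metric.ball 0 ε₀ ×ˢ Set.Ioo (-δ₀) δ₀))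
    (hQ0 : Q 0 0 = 0)
    (hPrad : ∀ z ∈ Metric.ball (0 : ℂ) ε₀, P z = P ((‖z‖ : ℝ) : ℂ))
    (hQrad : ∀ z ∈ Metric.ball (0 : ℂ) ε₀, ∀ t ∈ Set.Ioo (-δ₀) δ₀, Q z t = Q ((‖z‖ : ℝ) : ℂ) t)
    (hPpos : ∀ z ∈ Metric.ball (0 : ℂ) ε₀, z ≠ 0 → 0 < P z)
    (hPflat : VanishesToInfiniteOrderAt P 0) : IsModelGerm P Q := by
  have hball : Metric.ball (0 : ℂ) ε₀ ∈ 𝓝 0 := Metric.ball_mem_nhds _ hε₀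
  have hprod : Metric.ball (0 : ℂ) ε₀ ×ˢ Set.Ioo (-δ₀) δ₀ ∈ 𝓝 (0 : ℂ × ℝ) :=
    prod_mem_nhds hball (Ioo_mem_nhds (neg_lt_zero.2 hδ₀) hδ₀)
  refine ⟨⟨hP.contDiffAt hball, hPflat, ?_, ?_⟩, hQ0, ?_, ?_⟩
  · filter_upwards [hball] with z hz using hPrad z hz
  · filter_upwards [hball] with z hz using hPpos z hz
  · obtain ⟨K, s, hs, hK⟩ := (contDiffAt_infty.1 (hQ.contDiffAt hprod) 1).exists_lipschitzOnWith
    refine IsBigO.of_bound K ?_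
    filter_upwards [prod_mem_nhds hs hs] with x hx
    exact hK.norm_sub_le hx.1 hx.2
  · filter_upwards [hprod] with x hx using hQrad x.1 hx.1 x.2 hx.2

end StabilityGroup

theorem theoremB_general {ε₀ δ₀ : ℝ} (hε₀ : 0 < ε₀) (hδ₀ : 0 < δ₀) {P : ℂ → ℝ} {Q : ℂ → ℝ → ℝ}
    (h : IsModelGerm P Q) :
    stabilityGroup (graphHypersurface ε₀ δ₀ P Q) 0 =
      Set.range fun t : ℝ => (rotationMap t : (𝓝 (0 : ℂ × ℂ)).Germ (ℂ × ℂ)) := by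
  refine Set.Subset.antisymm ?_ (Set.range_subset_iff.2 (h.rotationMap_mem_stabilityGroup hε₀ hδ₀))
  rintro F ⟨f, rfl, hf, hf0, hmaps⟩
  obtain ⟨t, ht⟩ := h.exists_eventually_eq_rotationMap hε₀ hδ₀ hf hf0 hmaps
  exact ⟨t, Germ.coe_eq.2 ht.symm⟩

theorem theoremB (ε₀ δ₀ : ℝ) (hε₀ : 0 < ε₀) (hδ₀ : 0 < δ₀)
    (P : ℂ → ℝ) (Q : ℂ → ℝ → ℝ)
    (hP : ContDiffOn ℝ ∞ P (Metric.ball 0 ε₀))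
    (hQ : ContDiffOn ℝ ∞ (fun x : ℂ × ℝ => Q x.1 x.2)
      (Metric.ball 0 ε₀ ×ˢ Set.Ioo (-δ₀) δ₀))
    (hP0 : P 0 = 0) (hQ0 : Q 0 0 = 0)
    (hPrad : ∀ z ∈ Metric.ball (0 : ℂ) ε₀, P z = P ((‖z‖ : ℝ) : ℂ))
    (hQrad : ∀ z ∈ Metric.ball (0 : ℂ) ε₀, ∀ t ∈ Set.Ioo (-δ₀) δ₀,
      Q z t = Q ((‖z‖ : ℝ) : ℂ) t)
    (hPpos : ∀ z ∈ Metric.ball (0 : ℂ) ε₀, z ≠ 0 → 0 < P z)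
    (hPflat : VanishesToInfiniteOrderAt P 0) :
    stabilityGroup (graphHypersurface ε₀ δ₀ P Q) 0 =
      Set.range fun t : ℝ => (rotationMap t : (𝓝 (0 : ℂ × ℂ)).Germ (ℂ × ℂ)) := by
  exact theoremB_general hε₀ hδ₀
    (isModelGerm_of_contDiffOn hε₀ hδ₀ hP hQ hQ0 hPrad hQrad hPpos hPflat)
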